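/- **Setting.** Identify $\mathbb{C}^4$ with $\mathbb{H}^2$ by $(z_0,z_1,z_2,z_3)\mapsto(z_0+z_1j,\,z_2+z_3j)$, and let $\pi:S^7\to\mathbb{CP}^3$ be the Hopf fibration. Let $J_\circ$ be the almost complex structure of $\mathbb{CP}^3$ induced by multiplication by $i$, and $g_\circ$ the Fubini–Study metric for which $\pi$ is a Riemannian submersion (holomorphic sectional curvature $4$). Let $\mathcal D_1=d\pi(\mathrm{span}\{jp,kp\})$, let $\mathcal D_2$ be the image under $d\pi$ of the orthogonal complement of $\mathrm{span}\{ip,jp,kp\}$ in $T_pS^7$, and let $P$ be $-1$ on $\mathcal D_1$ and $+1$ on $\mathcal D_2$. The nearly Kähler structure of $\mathbb{CP}^3$ is $J=PJ_\circ$, $g(X,Y)=\tfrac32 g_\circ(X,Y)+\tfrac12 g_\circ(X,PY)$. Put $G=\nabla J$, i.e. $G(X,Y)=(\nabla_XJ)Y$, with $\nabla$ the Levi-Civita connection of $g$. Let $f:M\to\mathbb{CP}^3$ be a smooth immersion of a smooth $2$-manifold which is totally real in the nearly Kähler $\mathbb{CP}^3$: $g(X,JY)=0$ for all tangent vectors $X,Y$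 of $M$. The surface is called *totally real for $J_\circ$* if $g_\circ(X,J_\circ Y)=0$ for all tangent $X,Y$, and *almost complex for Kähler $\mathbb{CP}^3$* if $J_\circ(TM)\subseteq TM$. **Types.** Let $O\subseteq M$ be open. For a smooth $g$-orthonormal frame $U,V$ of $M$ on $O$ and functions $b_i,c_i$ consider $$J_\circ U=b_1V+b_2JU+b_4G(U,V)+b_5JG(U,V),\qquad J_\circ V=-b_1U+c_3JV+c_4G(U,V)+c_5JG(U,V).\quad(*)$$ * $M$ is of *Type 0 on $O$ with function $\lambda$* if there are such a frame and smooth functions $\lambda$, $\theta$ and $\alpha$ on $O$, $\alpha$ with values in $\left]-\tfrac\pi2,\tfrac\pi2\right[$, such that $(*)$ holds on $O$ with $$b_1=\tfrac{\lambda}{1+\lambda^2}(1-\sin\alpha),\quad b_2=\tfrac{\lambda^2+\sin\alpha}{1+\lambda^2},\quad b_4=\tfrac{\cos\alpha\sin\theta}{\sqrt{1+\lambda^2}},\quad b_5=\tfrac{\cos\alpha\cos\theta}{\sqrt{1+\lambda^2}},$$ $$c_3=\tfrac{1+\lambda^2\sin\alpha}{1+\lambda^2},\quad c_4=\tfrac{\lambda\cos\alpha\cos\theta}{\sqrt{1+\lambda^2}},\quad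 c_5=-\tfrac{\lambda\cos\alpha\sin\theta}{\sqrt{1+\lambda^2}}.$$ * $M$ is of *Type 2 on $O$ with function $\alpha$* if there are such a frame and a smooth function $\alpha$ on $O$ such that $(*)$ holds on $O$ with $b_1=\cos\alpha$, $b_2=\sin\alpha$, $c_3=-\sin\alpha$, $b_4=b_5=c_4=c_5=0$. **Proposition.** 1. $M$ is totally real for $J_\circ$ if and only if there is an open dense subset $D\subseteq M$ every point of which has an open neighbourhood $O$ on which $M$ is of Type 0 with $\lambda=0$ identically, or of Type 2 with $\cos\alpha=0$ identically. 2. $M$ is almost complex for Kähler $\mathbb{CP}^3$ if and only if there is an open dense subset $D\subseteq M$ every point of which has an open neighbourhood $O$ on which $M$ is of Type 2 with $\sin\alpha=0$ identically. -/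

import Mathlib

open scoped Manifold ContDiff ComplexConjugate

noncomputable section

namespace NKCP3

/-! ### Complex projective space as a smooth manifold -/

/-- `ℂ⁴` with its standard Hermitian inner product. -/
abbrev C4 : Type := EuclideanSpace ℂ (Fin 4)

/-- The model space of `ℂP³`; it is regarded as a real vector space of dimension six. -/
abbrev C3 : Type := Fin 3 → ℂ

/-- Complex projective three-space: the complex lines in `ℂ⁴`. -/
abbrev CP3 : Type := Projectivization ℂ C4

/-- The quotient map `ℂ⁴ ∖ {0} → ℂP³` (with an irrelevant value at `0`); its restriction to the
unit sphere is the Hopf fibration `S⁷ → ℂP³`. -/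
def hopf (v : C4) : CP3 :=
  open Classical in
  if h : v ≠ 0 then Projectivization.mk ℂ v h
  else Projectivization.mk ℂ (EuclideanSpace.single 0 1) (by simp)

theorem hopf_rep (x : CP3) : hopf x.rep = x := by
  rw [hopf, dif_pos x.rep_nonzero]
  exact Projectivization.mk_rep x

theorem hopf_eq_iff {v w : C4} (hv : v ≠ 0) (hw : w ≠ 0) :
    hopf v = hopf w ↔ ∃ a : ℂ, a • w = v := by
  rw [hopf, hopf, dif_pos hv, dif_pos hw]
  exact Projectivization.mk_eq_mk_iff' ℂ v w hv hw

theorem hopf_smul {a : ℂ} (ha : a ≠ 0) {v : C4} (hv : v ≠ 0) : hopf (a • v) = hopf v :=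
  (hopf_eq_iff (smul_ne_zero ha hv) hv).2 ⟨a, rfl⟩

/-- `ℂP³` carries the quotient topology. -/
instance : TopologicalSpace CP3 :=
  TopologicalSpace.coinduced (fun v : {v : C4 // v ≠ 0} => hopf v) inferInstance

theorem isQuotientMap_hopf :
    Topology.IsQuotientMap (fun v : {v : C4 // v ≠ 0} => hopf v) :=
  ⟨⟨rfl⟩, fun x => ⟨⟨x.rep, x.rep_nonzero⟩, hopf_rep x⟩⟩

theorem exists_smul_rep {v : C4} (hv : v ≠ 0) : ∃ a : ℂ, a ≠ 0 ∧ (hopf v).rep = a • v := by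
  obtain ⟨a, ha⟩ := (hopf_eq_iff (hopf v).rep_nonzero hv).1 (hopf_rep _)
  refine ⟨a, ?_, ha.symm⟩
  rintro rfl
  exact (hopf v).rep_nonzero (by rw [← ha, zero_smul])

/-- A unitary basis of `ℂ⁴`; each of them gives an affine chart of `ℂP³`. -/
abbrev UBasis : Type := OrthonormalBasis (Fin 4) ℂ C4

/-- The affine coordinates `zᵢ = ⟨bᵢ, v⟩ / ⟨b₀, v⟩` of the line through `v`. -/
def affineCoord (b : UBasis) (v : C4) : C3 :=
  fun i => inner ℂ (b i.succ) v / inner ℂ (b 0) v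

/-- The vector `b₀ + ∑ zᵢ bᵢ` with affine coordinates `z`. -/
def affineVec (b : UBasis) (z : C3) : C4 := b 0 + ∑ i, z i • b i.succ

theorem affineCoord_smul (b : UBasis) {a : ℂ} (ha : a ≠ 0) (v : C4) :
    affineCoord b (a • v) = affineCoord b v := by
  funext i
  simp only [affineCoord, inner_smul_right]
  exact mul_div_mul_left _ _ ha

theorem inner_zero_affineVec (b : UBasis) (z : C3) : inner ℂ (b 0) (affineVec b z) = 1 := by
  have h : ∀ i : Fin 3, inner ℂ (b 0) (b i.succ) = 0 := fun i =>
    b.orthonormal.2 (Fin.succ_ne_zero i).symm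
  simp [affineVec, h]

theorem inner_succ_affineVec (b : UBasis) (z : C3) (i : Fin 3) :
    inner ℂ (b i.succ) (affineVec b z) = z i := by
  have h0 : inner ℂ (b i.succ) (b 0) = 0 := b.orthonormal.2 (Fin.succ_ne_zero i)
  have h : ∀ k : Fin 3, inner ℂ (b i.succ) (b k.succ) = if i = k then 1 else 0 := fun k => by
    rw [orthonormal_iff_ite.1 b.orthonormal]
    simp
  simp [affineVec, h, h0]

theorem affineVec_ne_zero (b : UBasis) (z : C3) : affineVec b z ≠ 0 := by
  intro h
  have := inner_zero_affineVec b z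
  simp [h] at this

theorem affineCoord_affineVec (b : UBasis) (z : C3) : affineCoord b (affineVec b z) = z := by
  funext i
  simp [affineCoord, inner_zero_affineVec, inner_succ_affineVec]

theorem smul_affineVec_affineCoord (b : UBasis) {v : C4} (hv : inner ℂ (b 0) v ≠ 0) :
    inner ℂ (b 0) v • affineVec b (affineCoord b v) = v := by
  conv_rhs => rw [← b.sum_repr' v]
  rw [Fin.sum_univ_succ, affineVec, smul_add, Finset.smul_sum]
  congr 1
  refine Finset.sum_congr rfl fun i _ => ?_
  rw [smul_smul, affineCoord, mul_div_cancel₀ _ hv]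

theorem contDiff_affineVec (b : UBasis) : ContDiff ℝ ∞ (affineVec b) := by
  unfold affineVec
  fun_prop

theorem contDiffOn_affineCoord (b : UBasis) :
    ContDiffOn ℝ ∞ (affineCoord b) {v | inner ℂ (b 0) v ≠ 0} := by
  rw [contDiffOn_pi]
  intro i
  have h : ∀ w : C4, ContDiff ℝ ∞ (fun v : C4 => (inner ℂ w v : ℂ)) := fun w =>
    ((innerSL ℂ w).restrictScalars ℝ).contDiff
  simp only [affineCoord, div_eq_mul_inv]
  exact (h _).contDiffOn.mul ((h _).contDiffOn.inv fun v hv => hv)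

theorem isOpen_inner_ne_zero (b : UBasis) : IsOpen {v : C4 | inner ℂ (b 0) v ≠ 0} :=
  isOpen_ne_fun (by fun_prop) (by fun_prop)

/-- The affine chart of `ℂP³` given by a unitary basis `b`: it is defined on the lines not
orthogonal to `b₀`, and its centre is the line through `b₀`. -/
def affineChart (b : UBasis) : OpenPartialHomeomorph CP3 C3 where
  toFun x := affineCoord b x.rep
  invFun z := hopf (affineVec b z)
  source := {x | inner ℂ (b 0) x.rep ≠ 0}
  target := Set.univ
  map_source' _ _ := Set.mem_univ _
  map_target' z _ := by
    obtain ⟨a, ha, h⟩ := exists_smul_rep (affineVec_ne_zero b z)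
    simp [h, inner_zero_affineVec, ha]
  left_inv' x hx := by
    rw [← hopf_smul hx (affineVec_ne_zero b _), smul_affineVec_affineCoord b hx, hopf_rep]
  right_inv' z _ := by
    obtain ⟨a, ha, h⟩ := exists_smul_rep (affineVec_ne_zero b z)
    rw [h, affineCoord_smul b ha, affineCoord_affineVec]
  open_source := by
    rw [← isQuotientMap_hopf.isOpen_preimage]
    have : (fun v : {v : C4 // v ≠ 0} => hopf v) ⁻¹' {x | inner ℂ (b 0) x.rep ≠ 0}
        = Subtype.val ⁻¹' {v : C4 | inner ℂ (b 0) v ≠ 0} := by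
      ext ⟨v, hv⟩
      obtain ⟨a, ha, h⟩ := exists_smul_rep hv
      simp [h, ha]
    rw [this]
    exact (isOpen_inner_ne_zero b).preimage continuous_subtype_val
  open_target := isOpen_univ
  continuousOn_toFun := by
    have hopen : IsOpen {x : CP3 | inner ℂ (b 0) x.rep ≠ 0} := by
      rw [← isQuotientMap_hopf.isOpen_preimage]
      have : (fun v : {v : C4 // v ≠ 0} => hopf v) ⁻¹' {x | inner ℂ (b 0) x.rep ≠ 0}
          = Subtype.val ⁻¹' {v : C4 | inner ℂ (b 0) v ≠ 0} := by
        ext ⟨v, hv⟩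
        obtain ⟨a, ha, h⟩ := exists_smul_rep hv
        simp [h, ha]
      rw [this]
      exact (isOpen_inner_ne_zero b).preimage continuous_subtype_val
    rw [isQuotientMap_hopf.continuousOn_isOpen_iff hopen]
    have h1 : ContinuousOn (fun v : {v : C4 // v ≠ 0} => affineCoord b v)
        {v | inner ℂ (b 0) (v : C4) ≠ 0} :=
      (contDiffOn_affineCoord b).continuousOn.comp continuous_subtype_val.continuousOn
        fun v hv => hv
    have h2 : (fun x : CP3 => affineCoord b x.rep) ∘ (fun v : {v : C4 // v ≠ 0} => hopf v)
        = fun v : {v : C4 // v ≠ 0} => affineCoord b v := by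
      funext ⟨v, hv⟩
      obtain ⟨a, ha, h⟩ := exists_smul_rep hv
      simp [h, affineCoord_smul b ha]
    rw [h2]
    refine h1.mono ?_
    rintro ⟨v, hv⟩ hx
    obtain ⟨a, ha, h⟩ := exists_smul_rep hv
    simpa [h, ha] using hx
  continuousOn_invFun :=
    (isQuotientMap_hopf.continuous.comp
      ((contDiff_affineVec b).continuous.subtype_mk (affineVec_ne_zero b))).continuousOn

theorem exists_adapted_basis (x : CP3) : ∃ b : UBasis, hopf (b 0) = x := by
  have hx := x.rep_nonzero
  have hn : ‖x.rep‖ ≠ 0 := norm_ne_zero_iff.2 hx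
  let u : C4 := ((‖x.rep‖ : ℂ)⁻¹) • x.rep
  have hu : ‖u‖ = 1 := by
    simp [u, norm_smul, hn]
  obtain ⟨b, hb⟩ := Orthonormal.exists_orthonormalBasis_extension_of_card_eq (𝕜 := ℂ)
    (E := C4) (ι := Fin 4) (by simp) (v := fun _ => u) (s := {0})
    ⟨fun _ => hu, fun i j hij => (hij (Subsingleton.elim i j)).elim⟩
  refine ⟨b, ?_⟩
  rw [hb 0 rfl]
  change hopf (((‖x.rep‖ : ℂ)⁻¹) • x.rep) = x
  rw [hopf_smul (inv_ne_zero (by exact_mod_cast hn)) hx, hopf_rep]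

/-- A chosen unitary basis `b` of `ℂ⁴` whose first vector spans the line `x`. -/
def adaptedBasis (x : CP3) : UBasis := (exists_adapted_basis x).choose

theorem hopf_adaptedBasis (x : CP3) : hopf (adaptedBasis x 0) = x :=
  (exists_adapted_basis x).choose_spec

theorem UBasis.ne_zero (b : UBasis) (i : Fin 4) : b i ≠ 0 := b.orthonormal.ne_zero i

/-- The smooth structure of `ℂP³`: all affine charts of unitary bases, where the preferred chart
at `x` is centred at `x`. -/
instance : ChartedSpace C3 CP3 where
  atlas := Set.range affineChart
  chartAt x := affineChart (adaptedBasis x)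
  mem_chart_source x := by
    change inner ℂ (adaptedBasis x 0) x.rep ≠ 0
    obtain ⟨a, ha, h⟩ := exists_smul_rep (UBasis.ne_zero (adaptedBasis x) 0)
    rw [hopf_adaptedBasis] at h
    simp [h, ha]
  chart_mem_atlas x := Set.mem_range_self _

/-- `ℂP³` as a real smooth manifold. -/
instance : IsManifold 𝓘(ℝ, C3) ∞ CP3 := by
  refine isManifold_of_contDiffOn _ _ _ ?_
  rintro _ _ ⟨b, rfl⟩ ⟨b', rfl⟩
  have h : ∀ z : C3, affineCoord b' (hopf (affineVec b z)).rep
      = affineCoord b' (affineVec b z) := fun z => by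
    obtain ⟨a, ha, h⟩ := exists_smul_rep (affineVec_ne_zero b z)
    rw [h, affineCoord_smul b' ha]
  have key : ContDiffOn ℝ ∞ (fun z => affineCoord b' (hopf (affineVec b z)).rep)
      {z | inner ℂ (b' 0) (affineVec b z) ≠ 0} := by
    simp only [h]
    exact (contDiffOn_affineCoord b').comp (contDiff_affineVec b).contDiffOn fun z hz => hz
  refine key.mono ?_
  rintro z ⟨hz, -⟩
  have hz' : inner ℂ (b' 0) (hopf (affineVec b z)).rep ≠ 0 := by
    simpa [affineChart] using hz
  obtain ⟨a, ha, h⟩ := exists_smul_rep (affineVec_ne_zero b z)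
  rw [h, inner_smul_right] at hz'
  exact right_ne_zero_of_mul hz'

/-! ### The tensors of `ℂP³`

Put `q = adaptedBasis x 0`, a point of the unit sphere `S⁷` over `x`. The chart `chartAt C3 x` is
centred at `x` and identifies the tangent space of `ℂP³` at `x` with `C3`. In these terms the
differential of the Hopf fibration at `q` is `hopfPush x`, and `horLift x` is its inverse on the
horizontal space, the Hermitian orthogonal complement of `q` (see `mfderiv_hopf` below). -/

/-- The tangent space of `ℂP³` at `x`. -/
abbrev TCP3 (x : CP3) : Type := TangentSpace 𝓘(ℝ, C3) x

/-- The horizontal lift to the point `adaptedBasis x 0` of `S⁷` of tangent vectors at `x`. -/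
def horLift (x : CP3) : TCP3 x →ₗ[ℝ] C4 where
  toFun X := ∑ i, (X : C3) i • adaptedBasis x i.succ
  map_add' X Y := by
    rw [← Finset.sum_add_distrib]
    exact Finset.sum_congr rfl fun i _ => add_smul _ _ _
  map_smul' c X := by
    rw [Finset.smul_sum]
    exact Finset.sum_congr rfl fun i _ => smul_assoc c ((X : C3) i) _

/-- The differential of the Hopf fibration at the point `adaptedBasis x 0` of `S⁷`. -/
def hopfPush (x : CP3) : C4 →ₗ[ℝ] TCP3 x where
  toFun w := fun i => inner ℂ (adaptedBasis x i.succ) w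
  map_add' _ _ := funext fun _ => inner_add_right _ _ _
  map_smul' c _ := funext fun _ => inner_smul_right_eq_smul _ _ c

theorem hasFDerivAt_affineCoord (b : UBasis) {v : C4} (hv : inner ℂ (b 0) v ≠ 0)
    (h : ∀ i : Fin 3, inner ℂ (b i.succ) v = 0) :
    HasFDerivAt (affineCoord b) (ContinuousLinearMap.pi fun i =>
      (((inner ℂ (b 0) v)⁻¹ • innerSL ℂ (b i.succ) : C4 →L[ℂ] ℂ).restrictScalars ℝ)) v := by
  rw [hasFDerivAt_pi]
  intro i
  have hd : ∀ w : C4, HasFDerivAt (fun v : C4 => (inner ℂ w v : ℂ)) (innerSL ℂ w) v := fun w =>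
    (innerSL ℂ w).hasFDerivAt
  have hinv : DifferentiableAt ℂ (fun v : C4 => (inner ℂ (b 0) v : ℂ)⁻¹) v :=
    (hd (b 0)).differentiableAt.inv hv
  have key := ((hd (b i.succ)).mul hinv.hasFDerivAt).restrictScalars ℝ
  simp only [affineCoord, div_eq_mul_inv]
  refine key.congr_fderiv ?_
  ext w
  simp [h i]

/-- The vector `v` is a multiple of the first vector of the unitary basis adapted to its line. -/
theorem eq_smul_adaptedBasis {v : C4} (hv : v ≠ 0) :
    inner ℂ (adaptedBasis (hopf v) 0) v ≠ 0 ∧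
      v = inner ℂ (adaptedBasis (hopf v) 0) v • adaptedBasis (hopf v) 0 := by
  obtain ⟨a, ha⟩ := (hopf_eq_iff hv (UBasis.ne_zero (adaptedBasis (hopf v)) 0)).1
    (hopf_adaptedBasis _).symm
  have h1 : inner ℂ (adaptedBasis (hopf v) 0) v = a := by
    have h2 : inner ℂ (adaptedBasis (hopf v) 0) (a • adaptedBasis (hopf v) 0) = a := by
      rw [inner_smul_right, inner_self_eq_norm_sq_to_K, (adaptedBasis (hopf v)).orthonormal.1]
      simp
    rwa [ha] at h2
  rw [h1]
  refine ⟨?_, ha.symm⟩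
  rintro rfl
  exact hv (by rw [← ha, zero_smul])

theorem inner_succ_adaptedBasis {v : C4} (hv : v ≠ 0) (i : Fin 3) :
    inner ℂ (adaptedBasis (hopf v) i.succ) v = 0 := by
  have h2 : inner ℂ (adaptedBasis (hopf v) i.succ)
      (inner ℂ (adaptedBasis (hopf v) 0) v • adaptedBasis (hopf v) 0) = 0 := by
    rw [inner_smul_right, (adaptedBasis (hopf v)).orthonormal.2 (Fin.succ_ne_zero i), mul_zero]
  rwa [← (eq_smul_adaptedBasis hv).2] at h2

/-- The quotient map `ℂ⁴ ∖ {0} → ℂP³` is differentiable, and its differential. -/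
theorem hasMFDerivAt_hopf {v : C4} (hv : v ≠ 0) :
    HasMFDerivAt 𝓘(ℝ, C4) 𝓘(ℝ, C3) hopf v
      (ContinuousLinearMap.pi fun i =>
        (((inner ℂ (adaptedBasis (hopf v) 0) v)⁻¹ • innerSL ℂ (adaptedBasis (hopf v) i.succ) :
          C4 →L[ℂ] ℂ).restrictScalars ℝ) : C4 →L[ℝ] C3) := by
  have hev : ∀ᶠ w in nhds v, w ≠ (0 : C4) := isOpen_ne.mem_nhds hv
  refine ⟨?_, ?_⟩
  · have : ContinuousOn hopf {w : C4 | w ≠ 0} :=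
      continuousOn_iff_continuous_domRestrict.2 isQuotientMap_hopf.continuous
    exact this.continuousAt hev
  · have h := hasFDerivAt_affineCoord (adaptedBasis (hopf v)) (eq_smul_adaptedBasis hv).1
      (inner_succ_adaptedBasis hv)
    have h' : writtenInExtChartAt 𝓘(ℝ, C4) 𝓘(ℝ, C3) v hopf
        =ᶠ[nhds v] affineCoord (adaptedBasis (hopf v)) := by
      filter_upwards [hev] with w hw
      obtain ⟨a, ha, hr⟩ := exists_smul_rep hw
      change affineCoord (adaptedBasis (hopf v)) (hopf w).rep = _
      rw [hr, affineCoord_smul _ ha]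
    have h2 := (h.congr_of_eventuallyEq h').hasFDerivWithinAt (s := Set.range 𝓘(ℝ, C4))
    exact h2

/-- `hopfPush x` is the differential of the Hopf fibration at `adaptedBasis x 0`. -/
theorem mfderiv_hopf (x : CP3) (w : C4) :
    (mfderiv 𝓘(ℝ, C4) 𝓘(ℝ, C3) hopf (adaptedBasis x 0) w : C3) = hopfPush x w := by
  have h0 := UBasis.ne_zero (adaptedBasis x) 0
  rw [(hasMFDerivAt_hopf h0).mfderiv]
  funext i
  have h1 : inner ℂ (adaptedBasis x 0) (adaptedBasis x 0) = 1 := by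
    rw [inner_self_eq_norm_sq_to_K, (adaptedBasis x).orthonormal.1]
    simp
  rw [hopf_adaptedBasis, h1]
  change (1 : ℂ)⁻¹ • inner ℂ (adaptedBasis x i.succ) w = inner ℂ (adaptedBasis x i.succ) w
  rw [inv_one, one_smul]

theorem hopfPush_horLift (x : CP3) (X : TCP3 x) : hopfPush x (horLift x X) = X := by
  funext i
  have h : ∀ k : Fin 3, inner ℂ (adaptedBasis x i.succ) (adaptedBasis x k.succ)
      = if i = k then 1 else 0 := fun k => by
    rw [orthonormal_iff_ite.1 (adaptedBasis x).orthonormal]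
    simp
  change inner ℂ (adaptedBasis x i.succ) (∑ k : Fin 3, (X : C3) k • adaptedBasis x k.succ) = _
  simp only [inner_sum, inner_smul_right, h, mul_ite, mul_one, mul_zero]
  exact (Finset.sum_ite_eq Finset.univ i _).trans (if_pos (Finset.mem_univ i))

theorem inner_horLift (x : CP3) (X : TCP3 x) :
    inner ℂ (adaptedBasis x 0) (horLift x X) = 0 := by
  have h : ∀ i : Fin 3, inner ℂ (adaptedBasis x 0) (adaptedBasis x i.succ) = 0 := fun i =>
    (adaptedBasis x).orthonormal.2 (Fin.succ_ne_zero i).symm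
  simp [horLift, h]

theorem horLift_hopfPush (x : CP3) (w : C4) :
    horLift x (hopfPush x w) = w - inner ℂ (adaptedBasis x 0) w • adaptedBasis x 0 := by
  rw [eq_sub_iff_add_eq']
  conv_rhs => rw [← (adaptedBasis x).sum_repr' w]
  rw [Fin.sum_univ_succ]
  rfl

/-- Left multiplication by `j` on `ℂ⁴ = ℍ²`, where `(z₀, z₁, z₂, z₃)` is identified with
`(z₀ + z₁ j, z₂ + z₃ j)`. Left multiplication by `i` is the scalar multiplication by `i`, and left
multiplication by `k = ij` is `v ↦ i • quatJ v`. -/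
def quatJ : C4 →ₗ[ℝ] C4 where
  toFun v := !₂[-conj (v 1), conj (v 0), -conj (v 3), conj (v 2)]
  map_add' v w := by
    ext i
    fin_cases i <;> simp [add_comm]
  map_smul' c v := by
    ext i
    fin_cases i <;> simp

/-- The distribution `D₁`, the image of `span {jq, kq}` under the Hopf fibration. -/
def distD1 (x : CP3) : Submodule ℝ (TCP3 x) :=
  (Submodule.span ℝ {quatJ (adaptedBasis x 0), Complex.I • quatJ (adaptedBasis x 0)}).map
    (hopfPush x)

/-- The distribution `D₂`, the image under the Hopf fibration of the orthogonal complement of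
`span {iq, jq, kq}` in the tangent space of `S⁷` at `q`. -/
def distD2 (x : CP3) : Submodule ℝ (TCP3 x) :=
  Submodule.map (hopfPush x)
    { carrier := {w | inner ℂ (adaptedBasis x 0) w = 0 ∧
        inner ℂ (quatJ (adaptedBasis x 0)) w = 0}
      add_mem' := fun h h' => ⟨by simp [h.1, h'.1],
        by simp [h.2, h'.2]⟩
      zero_mem' := by simp
      smul_mem' := fun c w h => ⟨by rw [inner_smul_right_eq_smul, h.1, smul_zero],
        by rw [inner_smul_right_eq_smul, h.2, smul_zero]⟩ }

theorem inner_quatJ_quatJ (v w : C4) : inner ℂ (quatJ v) (quatJ w) = inner ℂ w v := by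
  simp [quatJ, PiLp.inner_apply, Fin.sum_univ_four]
  ring

theorem inner_quatJ_self (v : C4) : inner ℂ v (quatJ v) = 0 := by
  simp [quatJ, PiLp.inner_apply, Fin.sum_univ_four]
  ring

theorem inner_quatJ_self' (v : C4) : inner ℂ (quatJ v) v = 0 := by
  rw [← inner_conj_symm, inner_quatJ_self, map_zero]

theorem quatJ_smul (c : ℂ) (v : C4) : quatJ (c • v) = conj c • quatJ v := by
  ext i
  fin_cases i <;> simp [quatJ]

/-- The standard almost complex structure `J∘` of `ℂP³`, induced by multiplication by `i`. -/
def kahlerJ (x : CP3) (X : TCP3 x) : TCP3 x := hopfPush x (Complex.I • horLift x X)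

/-- The Fubini-Study metric `g∘` (of constant holomorphic sectional curvature `4`), for which the
Hopf fibration is a Riemannian submersion. -/
def fubiniStudy (x : CP3) (X Y : TCP3 x) : ℝ := (inner ℂ (horLift x X) (horLift x Y)).re

/-- The almost product structure `P`: on the horizontal space it is the reflection which changes
the sign of the complex line spanned by `jq`, so it is `-1` on `D₁` and `1` on `D₂`. -/
def almostProd (x : CP3) (X : TCP3 x) : TCP3 x :=
  hopfPush x (horLift x X -
    (2 * inner ℂ (quatJ (adaptedBasis x 0)) (horLift x X)) • quatJ (adaptedBasis x 0))

theorem norm_quatJ_adaptedBasis (x : CP3) :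
    inner ℂ (quatJ (adaptedBasis x 0)) (quatJ (adaptedBasis x 0)) = 1 := by
  rw [inner_quatJ_quatJ, inner_self_eq_norm_sq_to_K, (adaptedBasis x).orthonormal.1]
  simp

theorem horLift_hopfPush_quatJ (x : CP3) (c : ℂ) :
    horLift x (hopfPush x (c • quatJ (adaptedBasis x 0))) = c • quatJ (adaptedBasis x 0) := by
  rw [horLift_hopfPush, inner_smul_right, inner_quatJ_self, mul_zero, zero_smul, sub_zero]

theorem almostProd_of_mem_distD1 (x : CP3) {A : TCP3 x} (hA : A ∈ distD1 x) :
    almostProd x A = -A := by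
  obtain ⟨w, hw, rfl⟩ := hA
  obtain ⟨a, b, rfl⟩ := Submodule.mem_span_pair.1 hw
  have h : a • quatJ (adaptedBasis x 0) + b • Complex.I • quatJ (adaptedBasis x 0)
      = ((a : ℂ) + b * Complex.I) • quatJ (adaptedBasis x 0) := by
    rw [add_smul, mul_smul, Complex.coe_smul, Complex.coe_smul]
  rw [h, almostProd, horLift_hopfPush_quatJ, inner_smul_right, norm_quatJ_adaptedBasis, ← map_neg]
  congr 1
  module

theorem almostProd_of_mem_distD2 (x : CP3) {X : TCP3 x} (hX : X ∈ distD2 x) :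
    almostProd x X = X := by
  obtain ⟨w, ⟨h0, h1⟩, rfl⟩ := hX
  rw [almostProd, horLift_hopfPush, h0, zero_smul, sub_zero, h1, mul_zero, zero_smul, sub_zero]

/-- The nearly Kähler almost complex structure `J = P J∘`. -/
def nkJ (x : CP3) (X : TCP3 x) : TCP3 x := almostProd x (kahlerJ x X)

/-- The nearly Kähler metric `g(X, Y) = (3/2) g∘(X, Y) + (1/2) g∘(X, P Y)`. -/
def nkMetric (x : CP3) (X Y : TCP3 x) : ℝ :=
  3 / 2 * fubiniStudy x X Y + 1 / 2 * fubiniStudy x X (almostProd x Y)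

theorem nkMetric_eq (x : CP3) (X Y : TCP3 x) :
    nkMetric x X Y = 2 * (inner ℂ (horLift x X) (horLift x Y)).re
      - (inner ℂ (horLift x X) (quatJ (adaptedBasis x 0))
          * inner ℂ (quatJ (adaptedBasis x 0)) (horLift x Y)).re := by
  have h : horLift x (almostProd x Y) = horLift x Y -
      (2 * inner ℂ (quatJ (adaptedBasis x 0)) (horLift x Y)) • quatJ (adaptedBasis x 0) := by
    rw [almostProd, map_sub, map_sub, hopfPush_horLift, horLift_hopfPush_quatJ]
  rw [nkMetric, fubiniStudy, fubiniStudy, h, inner_sub_right, inner_smul_right, Complex.sub_re,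
    mul_assoc, mul_comm (inner ℂ (quatJ (adaptedBasis x 0)) (horLift x Y))]
  simp
  ring

theorem nkMetric_pos (x : CP3) {X : TCP3 x} (hX : X ≠ 0) : 0 < nkMetric x X X := by
  have hw : horLift x X ≠ 0 := fun h => hX (by rw [← hopfPush_horLift x X, h, map_zero])
  have h1 : ‖inner ℂ (quatJ (adaptedBasis x 0)) (horLift x X)‖ ≤ ‖horLift x X‖ := by
    have hq : ‖quatJ (adaptedBasis x 0)‖ = 1 := by
      have h2 : ‖quatJ (adaptedBasis x 0)‖ ^ 2 = 1 := by
        rw [← inner_self_eq_norm_sq (𝕜 := ℂ), norm_quatJ_adaptedBasis]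
        simp
      nlinarith [norm_nonneg (quatJ (adaptedBasis x 0))]
    simpa [hq] using norm_inner_le_norm (𝕜 := ℂ) (quatJ (adaptedBasis x 0)) (horLift x X)
  have h2 : (inner ℂ (horLift x X) (horLift x X)).re = ‖horLift x X‖ ^ 2 := by
    rw [inner_self_eq_norm_sq_to_K]
    norm_cast
  have h3 : (inner ℂ (horLift x X) (quatJ (adaptedBasis x 0))
      * inner ℂ (quatJ (adaptedBasis x 0)) (horLift x X)).re
      = ‖inner ℂ (quatJ (adaptedBasis x 0)) (horLift x X)‖ ^ 2 := by
    rw [← inner_conj_symm (horLift x X), Complex.conj_mul']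
    norm_cast
  rw [nkMetric_eq, h2, h3]
  have := norm_pos_iff.2 hw
  nlinarith [norm_nonneg (inner ℂ (quatJ (adaptedBasis x 0)) (horLift x X))]

/-- The nearly Kähler metric as a bilinear form. -/
def nkForm (x : CP3) : TCP3 x →ₗ[ℝ] TCP3 x →ₗ[ℝ] ℝ :=
  LinearMap.mk₂ ℝ (nkMetric x)
    (fun X X' Y => by simp only [nkMetric_eq, map_add, inner_add_left, add_mul, Complex.add_re]; ring)
    (fun c X Y => by
      simp only [nkMetric_eq, map_smul, inner_smul_left_eq_smul, smul_mul_assoc, Complex.smul_re,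
        smul_eq_mul]; ring)
    (fun X Y Y' => by simp only [nkMetric_eq, map_add, inner_add_right, mul_add, Complex.add_re]; ring)
    (fun c X Y => by
      simp only [nkMetric_eq, map_smul, inner_smul_right_eq_smul, mul_smul_comm, Complex.smul_re,
        smul_eq_mul]; ring)

instance (x : CP3) : FiniteDimensional ℝ (TCP3 x) := inferInstanceAs (FiniteDimensional ℝ C3)

theorem exists_nkMetric_eq (x : CP3) (l : TCP3 x →ₗ[ℝ] ℝ) : ∃ W, ∀ Z, nkMetric x W Z = l Z := by
  have hinj : Function.Injective (nkForm x) := by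
    rw [injective_iff_map_eq_zero]
    intro X hX
    by_contra h
    exact (nkMetric_pos x h).ne' (LinearMap.congr_fun hX X)
  have hsurj : Function.Surjective (nkForm x) :=
    (LinearMap.injective_iff_surjective_of_finrank_eq_finrank
      (Subspace.dual_finrank_eq (K := ℝ) (V := TCP3 x)).symm).1 hinj
  obtain ⟨W, hW⟩ := hsurj l
  exact ⟨W, fun Z => LinearMap.congr_fun hW Z⟩

/-! ### The Levi-Civita connection and the tensor `G = ∇J` -/

/-- The nearly Kähler metric in the affine chart centred at `x`, at the point with coordinates `z`:
it is the pullback of `g` under the inverse of the chart. -/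
def chartMetric (x : CP3) (z Y Z : C3) : ℝ :=
  nkMetric ((chartAt C3 x).symm z)
    (mfderiv 𝓘(ℝ, C3) 𝓘(ℝ, C3) (chartAt C3 x).symm z Y)
    (mfderiv 𝓘(ℝ, C3) 𝓘(ℝ, C3) (chartAt C3 x).symm z Z)

/-- The almost complex structure `J` in the affine chart centred at `x`, at the point with
coordinates `z`. -/
def chartJ (x : CP3) (z Y : C3) : C3 :=
  mfderiv 𝓘(ℝ, C3) 𝓘(ℝ, C3) (chartAt C3 x) ((chartAt C3 x).symm z)
    (nkJ ((chartAt C3 x).symm z) (mfderiv 𝓘(ℝ, C3) 𝓘(ℝ, C3) (chartAt C3 x).symm z Y))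

/-- The linear part `z ↦ ∑ zᵢ bᵢ` of `affineVec b`. -/
def affineLin (b : UBasis) : C3 →L[ℝ] C4 :=
  ∑ i, ((ContinuousLinearMap.proj i : C3 →L[ℂ] ℂ).smulRight (b i.succ)).restrictScalars ℝ

theorem hasFDerivAt_affineVec (b : UBasis) (z : C3) :
    HasFDerivAt (affineVec b) (affineLin b) z := by
  have h : affineVec b = fun z => b 0 + affineLin b z := by
    funext z
    simp [affineVec, affineLin]
  rw [h]
  exact (affineLin b).hasFDerivAt.const_add _

theorem mfderiv_chart_symm (x : CP3) (z Y : C3) :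
    mfderiv 𝓘(ℝ, C3) 𝓘(ℝ, C3) (chartAt C3 x).symm z Y
      = mfderiv 𝓘(ℝ, C4) 𝓘(ℝ, C3) hopf (affineVec (adaptedBasis x) z)
          (affineLin (adaptedBasis x) Y) := by
  have h1 := hasMFDerivAt_hopf (affineVec_ne_zero (adaptedBasis x) z)
  have h2 := (hasFDerivAt_affineVec (adaptedBasis x) z).hasMFDerivAt
  have h3 := (h1.comp z h2).mfderiv
  rw [h1.mfderiv]
  exact congrArg (fun L : C3 →L[ℝ] C3 => L Y) h3

theorem horLift_mfderiv_hopf {v : C4} (hv : v ≠ 0) (w : C4) :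
    horLift (hopf v) (mfderiv 𝓘(ℝ, C4) 𝓘(ℝ, C3) hopf v w)
      = (inner ℂ (adaptedBasis (hopf v) 0) v)⁻¹ •
        (w - inner ℂ (adaptedBasis (hopf v) 0) w • adaptedBasis (hopf v) 0) := by
  have h : mfderiv 𝓘(ℝ, C4) 𝓘(ℝ, C3) hopf v w
      = hopfPush (hopf v) ((inner ℂ (adaptedBasis (hopf v) 0) v)⁻¹ • w) := by
    rw [(hasMFDerivAt_hopf hv).mfderiv]
    funext i
    change _ = inner ℂ (adaptedBasis (hopf v) i.succ) ((inner ℂ (adaptedBasis (hopf v) 0) v)⁻¹ • w)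
    rw [inner_smul_right]
    rfl
  rw [h, horLift_hopfPush, inner_smul_right, smul_sub, smul_smul]

/-- The nearly Kähler metric in terms of vectors of `ℂ⁴ ∖ {0}`. -/
theorem nkMetric_mfderiv_hopf {v : C4} (hv : v ≠ 0) (w w' : C4) :
    nkMetric (hopf v) (mfderiv 𝓘(ℝ, C4) 𝓘(ℝ, C3) hopf v w)
        (mfderiv 𝓘(ℝ, C4) 𝓘(ℝ, C3) hopf v w')
      = 2 * ((inner ℂ w w' : ℂ).re / ‖v‖ ^ 2
          - (inner ℂ w v * inner ℂ v w' : ℂ).re / ‖v‖ ^ 4)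
        - (inner ℂ w (quatJ v) * inner ℂ (quatJ v) w' : ℂ).re / ‖v‖ ^ 4 := by
  obtain ⟨hc, hvc⟩ := eq_smul_adaptedBasis hv
  rw [nkMetric_eq, horLift_mfderiv_hopf hv, horLift_mfderiv_hopf hv]
  have hb := (adaptedBasis (hopf v)).orthonormal.1 0
  generalize adaptedBasis (hopf v) 0 = b at *
  generalize inner ℂ b v = c at *
  subst hvc
  have hbb : inner ℂ b b = (1 : ℂ) := by
    rw [inner_self_eq_norm_sq_to_K, hb]
    simp
  have hn : ‖c • b‖ = ‖c‖ := by rw [norm_smul, hb, mul_one]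
  have hc2 : conj c * c = ((‖c‖ ^ 2 : ℝ) : ℂ) := by
    rw [Complex.conj_mul']
    norm_cast
  have hcn : ‖c‖ ≠ 0 := norm_ne_zero_iff.2 hc
  have hcc : conj c ≠ 0 := (map_ne_zero _).2 hc
  have hr : ∀ (s : ℂ) (k : ℕ), s.re / ‖c‖ ^ k = (s / ((‖c‖ ^ k : ℝ) : ℂ)).re := fun s k => by
    rw [Complex.div_ofReal_re]
  have h4 : ((‖c‖ ^ 4 : ℝ) : ℂ) = (conj c * c) ^ 2 := by
    rw [hc2]
    push_cast
    ring
  rw [hn, hr, hr, hr, h4, ← hc2]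
  simp only [inner_smul_left, inner_smul_right, inner_sub_left, inner_sub_right, quatJ_smul,
    inner_quatJ_self, inner_quatJ_self', hbb, map_inv₀, inner_conj_symm, Complex.conj_conj,
    mul_zero, mul_one, sub_zero, ← Complex.sub_re]
  rw [show (2 : ℝ) = ((2 : ℝ) : ℂ).re from rfl, ← Complex.re_ofReal_mul]
  rw [← Complex.re_ofReal_mul, ← Complex.sub_re, ← Complex.sub_re]
  congr 1
  push_cast
  field_simp
  ring

theorem chartMetric_eq (x : CP3) (z Y Z : C3) :
    chartMetric x z Y Z = nkMetric (hopf (affineVec (adaptedBasis x) z))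
      (mfderiv 𝓘(ℝ, C4) 𝓘(ℝ, C3) hopf (affineVec (adaptedBasis x) z)
        (affineLin (adaptedBasis x) Y))
      (mfderiv 𝓘(ℝ, C4) 𝓘(ℝ, C3) hopf (affineVec (adaptedBasis x) z)
        (affineLin (adaptedBasis x) Z)) := by
  rw [chartMetric, mfderiv_chart_symm, mfderiv_chart_symm]
  rfl

theorem differentiableAt_chartMetric (x : CP3) (z Y Z : C3) :
    DifferentiableAt ℝ (fun z => chartMetric x z Y Z) z := by
  have hv : DifferentiableAt ℝ (affineVec (adaptedBasis x)) z :=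
    (hasFDerivAt_affineVec _ z).differentiableAt
  have hj : DifferentiableAt ℝ (fun z => quatJ (affineVec (adaptedBasis x) z)) z :=
    (LinearMap.toContinuousLinearMap quatJ).differentiableAt.comp z hv
  have hn : DifferentiableAt ℝ (fun z => ‖affineVec (adaptedBasis x) z‖ ^ 2) z := by
    have h : (fun z => ‖affineVec (adaptedBasis x) z‖ ^ 2)
        = fun z => (inner ℂ (affineVec (adaptedBasis x) z) (affineVec (adaptedBasis x) z)).re := by
      funext z
      exact (inner_self_eq_norm_sq (𝕜 := ℂ) _).symm
    rw [h]
    exact Complex.reCLM.differentiableAt.comp z (hv.inner ℂ hv)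
  have hn0 : (fun z => ‖affineVec (adaptedBasis x) z‖ ^ 2) z ≠ 0 :=
    pow_ne_zero 2 (norm_ne_zero_iff.2 (affineVec_ne_zero _ z))
  have hn1 : (fun z => (‖affineVec (adaptedBasis x) z‖ ^ 2) ^ 2) z ≠ 0 := pow_ne_zero 2 hn0
  have e : ∀ r : ℝ, r ^ 4 = (r ^ 2) ^ 2 := fun r => by ring
  simp only [chartMetric_eq, nkMetric_mfderiv_hopf (affineVec_ne_zero _ _), e]
  have c : ∀ w : C4, DifferentiableAt ℝ (fun _ : C3 => w) z := fun w => differentiableAt_const w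
  have h1 := Complex.reCLM.differentiableAt.comp z
    (((c (affineLin (adaptedBasis x) Y)).inner ℂ hv).mul
      (hv.inner ℂ (c (affineLin (adaptedBasis x) Z))))
  have h2 := Complex.reCLM.differentiableAt.comp z
    (((c (affineLin (adaptedBasis x) Y)).inner ℂ hj).mul
      (hj.inner ℂ (c (affineLin (adaptedBasis x) Z))))
  have k0 := (differentiableAt_const (𝕜 := ℝ) (E := C3) (x := z)
    (inner ℂ (affineLin (adaptedBasis x) Y) (affineLin (adaptedBasis x) Z)).re).mul
    (hn.fun_inv hn0)
  have k1 := h1.mul ((hn.fun_pow 2).fun_inv hn1)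
  have k2 := h2.mul ((hn.fun_pow 2).fun_inv hn1)
  simp only [div_eq_mul_inv]
  exact ((k0.fun_sub k1).const_mul 2).fun_sub k2

theorem chartMetric_add (x : CP3) (z Y Z Z' : C3) :
    chartMetric x z Y (Z + Z') = chartMetric x z Y Z + chartMetric x z Y Z' := by
  have h := (nkForm ((chartAt C3 x).symm z)
    (mfderiv 𝓘(ℝ, C3) 𝓘(ℝ, C3) (chartAt C3 x).symm z Y)).map_add
    (mfderiv 𝓘(ℝ, C3) 𝓘(ℝ, C3) (chartAt C3 x).symm z Z)
    (mfderiv 𝓘(ℝ, C3) 𝓘(ℝ, C3) (chartAt C3 x).symm z Z')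
  have h' := (mfderiv 𝓘(ℝ, C3) 𝓘(ℝ, C3) (chartAt C3 x).symm z).map_add Z Z'
  rw [← h'] at h
  exact h

theorem chartMetric_smul (x : CP3) (c : ℝ) (z Y Z : C3) :
    chartMetric x z Y (c • Z) = c * chartMetric x z Y Z := by
  have h := (nkForm ((chartAt C3 x).symm z)
    (mfderiv 𝓘(ℝ, C3) 𝓘(ℝ, C3) (chartAt C3 x).symm z Y)).map_smul c
    (mfderiv 𝓘(ℝ, C3) 𝓘(ℝ, C3) (chartAt C3 x).symm z Z)
  have h' := (mfderiv 𝓘(ℝ, C3) 𝓘(ℝ, C3) (chartAt C3 x).symm z).map_smul c Z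
  rw [← h'] at h
  exact h

/-- The right-hand side `X g(Y, Z) + Y g(X, Z) - Z g(X, Y)` of Koszul's formula at `x` for
vector fields which are constant in the affine chart centred at `x`. -/
def koszul (x : CP3) (X Y Z : C3) : ℝ :=
  fderiv ℝ (fun z => chartMetric x z Y Z) (chartAt C3 x x) X
    + fderiv ℝ (fun z => chartMetric x z X Z) (chartAt C3 x x) Y
    - fderiv ℝ (fun z => chartMetric x z X Y) (chartAt C3 x x) Z

theorem exists_christoffel (x : CP3) (X Y : TCP3 x) :
    ∃ W : TCP3 x, ∀ Z : TCP3 x, 2 * nkMetric x W Z = koszul x X Y Z := by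
  have hadd : ∀ (A B Z Z' : C3),
      fderiv ℝ (fun z => chartMetric x z A (Z + Z')) (chartAt C3 x x) B
        = fderiv ℝ (fun z => chartMetric x z A Z) (chartAt C3 x x) B
          + fderiv ℝ (fun z => chartMetric x z A Z') (chartAt C3 x x) B := fun A B Z Z' => by
    simp only [chartMetric_add]
    rw [fderiv_fun_add (differentiableAt_chartMetric _ _ _ _)
      (differentiableAt_chartMetric _ _ _ _)]
    rfl
  have hsmul : ∀ (c : ℝ) (A B Z : C3),
      fderiv ℝ (fun z => chartMetric x z A (c • Z)) (chartAt C3 x x) B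
        = c * fderiv ℝ (fun z => chartMetric x z A Z) (chartAt C3 x x) B := fun c A B Z => by
    simp only [chartMetric_smul]
    rw [fderiv_const_mul (differentiableAt_chartMetric _ _ _ _)]
    rfl
  let l : C3 →ₗ[ℝ] ℝ :=
    { toFun := fun Z => 1 / 2 * koszul x X Y Z
      map_add' := fun Z Z' => by
        have h1 := hadd Y X Z Z'
        have h2 := hadd X Y Z Z'
        have h3 := (fderiv ℝ (fun z => chartMetric x z X Y) (chartAt C3 x x)).map_add Z Z'
        simp only [koszul]
        linear_combination (1 / 2) * h1 + (1 / 2) * h2 - (1 / 2) * h3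
      map_smul' := fun c Z => by
        have h1 := hsmul c Y X Z
        have h2 := hsmul c X Y Z
        have h3 := (fderiv ℝ (fun z => chartMetric x z X Y) (chartAt C3 x x)).map_smul c Z
        simp only [koszul, smul_eq_mul, RingHom.id_apply] at h3 ⊢
        linear_combination (1 / 2) * h1 + (1 / 2) * h2 - (1 / 2) * h3 }
  obtain ⟨W, hW⟩ := exists_nkMetric_eq x l
  refine ⟨W, fun Z => ?_⟩
  rw [hW]
  change 2 * (1 / 2 * koszul x X Y Z) = _
  ring

/-- The Christoffel symbol `Γ(X, Y)` at `x` of the Levi-Civita connection of `g` in the affine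
chart centred at `x`: the value at `x` of `∇_X Y` for vector fields which are constant in the
chart. By Koszul's formula and non-degeneracy it is determined by
`2 g(Γ(X, Y), Z) = X g(Y, Z) + Y g(X, Z) - Z g(X, Y)`. -/
def christoffel (x : CP3) (X Y : TCP3 x) : TCP3 x := (exists_christoffel x X Y).choose

/-- The tensor `G = ∇J`, that is `G(X, Y) = (∇_X J) Y = ∇_X (J Y) - J (∇_X Y)`, where `∇` is the
Levi-Civita connection of the nearly Kähler metric; it is computed at `x` in the affine chart
centred at `x`. -/
def nablaJ (x : CP3) (X Y : TCP3 x) : TCP3 x :=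
  let DJ : TCP3 x := fderiv ℝ (fun z => chartJ x z Y) (chartAt C3 x x) X
  DJ + christoffel x X (nkJ x Y) - nkJ x (christoffel x X Y)

/-! ### Surfaces in `ℂP³` -/

section Surfaces

variable {M : Type*} [TopologicalSpace M] [ChartedSpace (EuclideanSpace ℝ (Fin 2)) M]

/-- The differential of a map from a surface to `ℂP³`. -/
abbrev surfD (f : M → CP3) (p : M) : TangentSpace (𝓡 2) p →L[ℝ] TCP3 (f p) :=
  mfderiv (𝓡 2) 𝓘(ℝ, C3) f p

/-- `f : M → ℂP³` is a smooth immersion. -/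
structure IsImmersedSurface (f : M → CP3) : Prop where
  smooth : ContMDiff (𝓡 2) 𝓘(ℝ, C3) ∞ f
  injective : ∀ p, Function.Injective (surfD f p)

/-- The surface is totally real in the nearly Kähler `ℂP³`: `J` maps tangent vectors to normal
vectors for `g`. -/
def IsNKTotallyReal (f : M → CP3) : Prop :=
  ∀ (p : M) (X Y : TangentSpace (𝓡 2) p),
    nkMetric (f p) (surfD f p X) (nkJ (f p) (surfD f p Y)) = 0

/-- The surface is totally real in the Kähler `ℂP³`: `J∘` maps tangent vectors to normal vectors
for `g∘`. -/
def IsKahlerTotallyReal (f : M → CP3) : Prop :=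
  ∀ (p : M) (X Y : TangentSpace (𝓡 2) p),
    fubiniStudy (f p) (surfD f p X) (kahlerJ (f p) (surfD f p Y)) = 0

/-- The surface is almost complex in the Kähler `ℂP³`: its tangent spaces are `J∘`-invariant. -/
def IsKahlerAlmostComplex (f : M → CP3) : Prop :=
  ∀ (p : M) (X : TangentSpace (𝓡 2) p), ∃ Y : TangentSpace (𝓡 2) p,
    kahlerJ (f p) (surfD f p X) = surfD f p Y

variable [IsManifold (𝓡 2) ∞ M]

/-- `(U, V)` is a smooth frame of the surface on the open set `O`, orthonormal for the metric
induced by `g`. -/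
structure IsOrthonormalFrameOn (f : M → CP3) (O : Set M)
    (U V : ∀ p : M, TangentSpace (𝓡 2) p) : Prop where
  smooth_fst : ContMDiffOn (𝓡 2) (𝓡 2).tangent ∞
    (fun p => (⟨p, U p⟩ : TangentBundle (𝓡 2) M)) O
  smooth_snd : ContMDiffOn (𝓡 2) (𝓡 2).tangent ∞
    (fun p => (⟨p, V p⟩ : TangentBundle (𝓡 2) M)) O
  fst_fst : ∀ p ∈ O, nkMetric (f p) (surfD f p (U p)) (surfD f p (U p)) = 1
  snd_snd : ∀ p ∈ O, nkMetric (f p) (surfD f p (V p)) (surfD f p (V p)) = 1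
  fst_snd : ∀ p ∈ O, nkMetric (f p) (surfD f p (U p)) (surfD f p (V p)) = 0

/-- At the point `p`, the structure `J∘` is given in terms of `U`, `V`, `JU`, `JV`, `G(U, V)` and
`JG(U, V)` by `J∘ U = b₁ V + b₂ JU + b₄ G(U, V) + b₅ JG(U, V)` and
`J∘ V = -b₁ U + c₃ JV + c₄ G(U, V) + c₅ JG(U, V)`. -/
def KahlerJInFrame (f : M → CP3) (U V : ∀ p : M, TangentSpace (𝓡 2) p) (p : M)
    (b₁ b₂ b₄ b₅ c₃ c₄ c₅ : ℝ) : Prop :=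
  let u := surfD f p (U p)
  let v := surfD f p (V p)
  let J := nkJ (f p)
  let G := nablaJ (f p)
  kahlerJ (f p) u = b₁ • v + b₂ • J u + b₄ • G u v + b₅ • J (G u v) ∧
    kahlerJ (f p) v = -b₁ • u + c₃ • J v + c₄ • G u v + c₅ • J (G u v)

/-- On the open set `O` the surface is of Type 0 with function `lam`: there are a smooth
orthonormal frame and smooth functions `α` (with values in `]-π/2, π/2[`) and `θ` on `O` giving
the coefficients of `J∘`. -/
def IsType0On (f : M → CP3) (O : Set M) (lam : M → ℝ) : Prop :=
  ∃ (U V : ∀ p : M, TangentSpace (𝓡 2) p) (α θ : M → ℝ),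
    IsOrthonormalFrameOn f O U V ∧
    ContMDiffOn (𝓡 2) 𝓘(ℝ, ℝ) ∞ lam O ∧ ContMDiffOn (𝓡 2) 𝓘(ℝ, ℝ) ∞ α O ∧
    ContMDiffOn (𝓡 2) 𝓘(ℝ, ℝ) ∞ θ O ∧
    ∀ p ∈ O, α p ∈ Set.Ioo (-(Real.pi / 2)) (Real.pi / 2) ∧
      KahlerJInFrame f U V p
        (lam p / (1 + lam p ^ 2) * (1 - Real.sin (α p)))
        ((lam p ^ 2 + Real.sin (α p)) / (1 + lam p ^ 2))
        (Real.cos (α p) * Real.sin (θ p) / √(1 + lam p ^ 2))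
        (Real.cos (α p) * Real.cos (θ p) / √(1 + lam p ^ 2))
        ((1 + lam p ^ 2 * Real.sin (α p)) / (1 + lam p ^ 2))
        (lam p * Real.cos (α p) * Real.cos (θ p) / √(1 + lam p ^ 2))
        (-(lam p * Real.cos (α p) * Real.sin (θ p) / √(1 + lam p ^ 2)))

/-- On the open set `O` the surface is of Type 2 with angle function `α`. -/
def IsType2On (f : M → CP3) (O : Set M) (α : M → ℝ) : Prop :=
  ∃ U V : ∀ p : M, TangentSpace (𝓡 2) p,
    IsOrthonormalFrameOn f O U V ∧ ContMDiffOn (𝓡 2) 𝓘(ℝ, ℝ) ∞ α O ∧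
    ∀ p ∈ O, KahlerJInFrame f U V p
      (Real.cos (α p)) (Real.sin (α p)) 0 0 (-Real.sin (α p)) 0 0

/-- `Q` holds on a neighbourhood of every point of some open dense subset of `M`. -/
def LocallyOnOpenDense (Q : Set M → Prop) : Prop :=
  ∃ D : Set M, IsOpen D ∧ Dense D ∧ ∀ p ∈ D, ∃ O : Set M, IsOpen O ∧ p ∈ O ∧ Q O

end Surfaces

end NKCP3

end

/-!
Near each point the surface has a smooth lift `v` to `S⁷`; let `a = ⟨jv, dv ·⟩` be the pull-back of
the complex contact form. Since `J∘` and `J` differ only on `𝒟₁`, which `a` measures, a totally real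
orthonormal frame satisfies `g(V, J∘ U) = 2 Im (a(V) conj (a(U)))`. The surface is totally real for
`J∘` at a point exactly when this function vanishes there, and almost complex exactly when its
square is `1`. Both are closed conditions, so they pass from a dense set to all of `M`.

If the function is `±1`, then `J∘ U = ±V`, which is Type 2 with `sin α = 0`. If it is `0`, then
`a(U)` and `a(V)` are real multiples of one complex number and a rotation of the frame makes
`a(V) = 0` wherever `a ≠ 0`. Then `J∘ V = J V` and the component of `J∘ U` along `J U` is
`sin α = 1 - 2 |a(U)|²`, which gives Type 0 with `λ = 0` where `|a(U)| < 1` and Type 2 with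
`α = -π/2` where `|a(U)| = 1`.

It remains to see that `a` cannot vanish on an open set. There the surface would be an integral
surface of the contact distribution, so `da = 0` on it, that is, `⟨jw, w'⟩ = 0` for the horizontal
lifts `w`, `w'` of `U`, `V`; this contradicts the identity `|a(U)|² + |a(V)|² + 4 |⟨jw, w'⟩|² = 1`,
valid for every totally real orthonormal frame.
-/

namespace NKCP3

/-! ### Tangent vectors of `ℂP³` and vectors of `ℂ⁴` -/

theorem inner_quatJ_antisymm (v w : C4) : inner ℂ (quatJ v) w = -inner ℂ (quatJ w) v := by
  simp only [quatJ, LinearMap.coe_mk, AddHom.coe_mk, PiLp.inner_apply, RCLike.inner_apply,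
    Fin.sum_univ_four, map_neg, RingHomCompTriple.comp_apply, RingHom.id_apply, Matrix.cons_val]
  ring

theorem quatJ_quatJ (v : C4) : quatJ (quatJ v) = -v := by
  ext i
  fin_cases i <;> simp [quatJ]

theorem norm_quatJ (v : C4) : ‖quatJ v‖ = ‖v‖ := by
  rw [← sq_eq_sq₀ (norm_nonneg _) (norm_nonneg _), ← inner_self_eq_norm_sq (𝕜 := ℂ),
    ← inner_self_eq_norm_sq (𝕜 := ℂ), inner_quatJ_quatJ]

theorem inner_adaptedBasis_self (x : CP3) :
    inner ℂ (adaptedBasis x 0) (adaptedBasis x 0) = (1 : ℂ) := by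
  rw [inner_self_eq_norm_sq_to_K, (adaptedBasis x).orthonormal.1]
  simp

theorem hopfPush_smul_adaptedBasis (x : CP3) (c : ℂ) :
    hopfPush x (c • adaptedBasis x 0) = 0 := by
  have h : horLift x (hopfPush x (c • adaptedBasis x 0)) = 0 := by
    rw [horLift_hopfPush, inner_smul_right, inner_adaptedBasis_self, mul_one, sub_self]
  rw [← hopfPush_horLift x (hopfPush x _), h, map_zero]

/-- The differential at `v` of the quotient map `ℂ⁴ ∖ {0} → ℂP³`, with values in the tangent space
at `x`. It is meaningful only if `x = hopf v`; keeping `x` as a variable avoids transporting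
tangent vectors along this equality. -/
noncomputable def hopfPushAt (x : CP3) (v : C4) : C4 →ₗ[ℝ] TCP3 x where
  toFun w := hopfPush x ((inner ℂ (adaptedBasis x 0) v)⁻¹ • w)
  map_add' w w' := by rw [smul_add, map_add]
  map_smul' c w := by
    rw [smul_comm, map_smul]
    rfl

theorem mfderiv_hopf_eq_hopfPushAt {v : C4} (hv : v ≠ 0) (w : C4) :
    mfderiv 𝓘(ℝ, C4) 𝓘(ℝ, C3) hopf v w = hopfPushAt (hopf v) v w := by
  rw [(hasMFDerivAt_hopf hv).mfderiv]
  funext i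
  change _ = inner ℂ (adaptedBasis (hopf v) i.succ) ((inner ℂ (adaptedBasis (hopf v) 0) v)⁻¹ • w)
  rw [inner_smul_right]
  rfl

theorem hopfPushAt_adaptedBasis (x : CP3) (w : C4) :
    hopfPushAt x (adaptedBasis x 0) w = hopfPush x w := by
  change hopfPush x ((inner ℂ (adaptedBasis x 0) (adaptedBasis x 0))⁻¹ • w) = _
  rw [inner_adaptedBasis_self, inv_one, one_smul]

section HopfPushAt

variable {x : CP3} {v : C4}

theorem exists_eq_smul_adaptedBasis (hv : v ≠ 0) (hx : hopf v = x) :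
    ∃ c : ℂ, c ≠ 0 ∧ v = c • adaptedBasis x 0 ∧
      ∀ w, hopfPushAt x v w = hopfPush x (c⁻¹ • w) := by
  subst hx
  obtain ⟨h1, h2⟩ := eq_smul_adaptedBasis hv
  exact ⟨_, h1, h2, fun w => rfl⟩

theorem hopfPushAt_smul_self (hv : v ≠ 0) (hx : hopf v = x) (c : ℂ) :
    hopfPushAt x v (c • v) = 0 := by
  obtain ⟨d, -, rfl, h⟩ := exists_eq_smul_adaptedBasis hv hx
  rw [h, smul_smul, smul_smul, hopfPush_smul_adaptedBasis]

theorem exists_hopfPushAt_eq (hv : v ≠ 0) (hx : hopf v = x) (X : TCP3 x) :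
    ∃ w, inner ℂ v w = 0 ∧ hopfPushAt x v w = X := by
  obtain ⟨d, hd, rfl, h⟩ := exists_eq_smul_adaptedBasis hv hx
  refine ⟨d • horLift x X, ?_, ?_⟩
  · rw [inner_smul_left, inner_smul_right, inner_horLift, mul_zero, mul_zero]
  · rw [h, smul_smul, inv_mul_cancel₀ hd, one_smul, hopfPush_horLift]

theorem kahlerJ_hopfPushAt (hv : v ≠ 0) (hx : hopf v = x) (w : C4) :
    kahlerJ x (hopfPushAt x v w) = hopfPushAt x v (Complex.I • w) := by
  obtain ⟨d, -, rfl, h⟩ := exists_eq_smul_adaptedBasis hv hx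
  rw [h, h, kahlerJ, horLift_hopfPush, smul_sub, map_sub, smul_smul Complex.I _ (adaptedBasis x 0),
    hopfPush_smul_adaptedBasis, sub_zero, smul_comm]

theorem nkJ_hopfPushAt (hv : v ≠ 0) (hx : hopf v = x) (w : C4) :
    nkJ x (hopfPushAt x v w) = hopfPushAt x v (Complex.I • w -
      (2 * Complex.I * inner ℂ (quatJ v) w / (‖v‖ ^ 2 : ℝ)) • quatJ v) := by
  rw [nkJ, kahlerJ_hopfPushAt hv hx]
  obtain ⟨d, hd, rfl, h⟩ := exists_eq_smul_adaptedBasis hv hx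
  rw [h, h, almostProd, horLift_hopfPush, sub_right_comm, map_sub, hopfPush_smul_adaptedBasis,
    sub_zero]
  have hn : ((‖d • adaptedBasis x 0‖ ^ 2 : ℝ) : ℂ) = conj d * d := by
    rw [norm_smul, (adaptedBasis x).orthonormal.1, mul_one, Complex.conj_mul']
    norm_cast
  have hc : conj d ≠ 0 := (map_ne_zero _).2 hd
  rw [hn, quatJ_smul, smul_sub, smul_comm d⁻¹ Complex.I w]
  congr 2
  simp only [smul_smul]
  congr 1
  simp only [inner_sub_right, inner_smul_right, inner_smul_left, inner_quatJ_self',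
    Complex.conj_conj]
  field_simp
  ring

theorem nkMetric_hopfPushAt (hv : ‖v‖ = 1) (hx : hopf v = x) (w w' : C4) :
    nkMetric x (hopfPushAt x v w) (hopfPushAt x v w')
      = 2 * (inner ℂ w w' - inner ℂ w v * inner ℂ v w' : ℂ).re
        - (inner ℂ w (quatJ v) * inner ℂ (quatJ v) w' : ℂ).re := by
  have hv0 : v ≠ 0 := norm_ne_zero_iff.1 (hv.trans_ne one_ne_zero)
  subst hx
  rw [← mfderiv_hopf_eq_hopfPushAt hv0, ← mfderiv_hopf_eq_hopfPushAt hv0,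
    nkMetric_mfderiv_hopf hv0, hv]
  simp

end HopfPushAt

theorem nkMetric_ext {x : CP3} {X X' : TCP3 x} (h : ∀ Z, nkMetric x X Z = nkMetric x X' Z) :
    X = X' := by
  by_contra hne
  have h1 := nkMetric_pos x (sub_ne_zero.2 hne)
  exact h1.ne' ((LinearMap.map_sub₂ (nkForm x) X X' (X - X')).trans (sub_eq_zero.2 (h _)))

/-! ### The tensor `G` -/

theorem chartAt_self (x : CP3) : chartAt C3 x x = (0 : C3) := by
  funext i
  change inner ℂ (adaptedBasis x i.succ) x.rep / inner ℂ (adaptedBasis x 0) x.rep = (0 : ℂ)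
  have h := inner_succ_adaptedBasis x.rep_nonzero i
  rw [hopf_rep] at h
  rw [h, zero_div]

theorem affineLin_eq_horLift (x : CP3) (Y : TCP3 x) :
    affineLin (adaptedBasis x) Y = horLift x Y := by
  simp [affineLin, horLift]
  rfl

theorem affineVec_zero (b : UBasis) : affineVec b 0 = b 0 := by
  simp [affineVec]

theorem affineVec_smul (b : UBasis) (t : ℝ) (X : C3) :
    affineVec b (t • X) = b 0 + t • affineLin b X := by
  simp [affineVec, affineLin, Finset.smul_sum, mul_smul]

theorem inner_zero_affineLin (b : UBasis) (X : C3) : inner ℂ (b 0) (affineLin b X) = 0 := by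
  have h : ∀ i : Fin 3, inner ℂ (b 0) (b i.succ) = 0 := fun i =>
    b.orthonormal.2 (Fin.succ_ne_zero i).symm
  simp [affineLin, h]

theorem inner_affineLin_zero (b : UBasis) (X : C3) : inner ℂ (affineLin b X) (b 0) = 0 := by
  rw [← inner_conj_symm, inner_zero_affineLin, map_zero]

theorem hasDerivAt_affineVec_smul (b : UBasis) (X : C3) :
    HasDerivAt (fun t : ℝ => affineVec b (t • X)) (affineLin b X) 0 := by
  simp only [affineVec_smul]
  simpa using ((hasDerivAt_id (0 : ℝ)).smul_const (affineLin b X)).const_add (b 0)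

theorem hasDerivAt_quatJ_affineVec_smul (b : UBasis) (X : C3) :
    HasDerivAt (fun t : ℝ => quatJ (affineVec b (t • X))) (quatJ (affineLin b X)) 0 :=
  (LinearMap.toContinuousLinearMap quatJ).hasFDerivAt.comp_hasDerivAt (0 : ℝ)
    (hasDerivAt_affineVec_smul b X)

theorem norm_sq_affineVec_smul (b : UBasis) (t : ℝ) (X : C3) :
    ‖affineVec b (t • X)‖ ^ 2 = 1 + t ^ 2 * ‖affineLin b X‖ ^ 2 := by
  have h : inner ℂ (b 0) (t • affineLin b X) = 0 := by
    rw [inner_smul_right_eq_smul, inner_zero_affineLin, smul_zero]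
  rw [affineVec_smul, sq, norm_add_sq_eq_norm_sq_add_norm_sq_of_inner_eq_zero _ _ h, norm_smul,
    b.orthonormal.1, Real.norm_eq_abs, mul_mul_mul_comm, abs_mul_abs_self]
  ring

theorem hasDerivAt_norm_sq_affineVec_smul (b : UBasis) (X : C3) :
    HasDerivAt (fun t : ℝ => ‖affineVec b (t • X)‖ ^ 2) 0 0 := by
  simp only [norm_sq_affineVec_smul]
  simpa using (((hasDerivAt_id (0 : ℝ)).fun_pow 2).mul_const (‖affineLin b X‖ ^ 2)).const_add 1

theorem hasDerivAt_chartMetric_smul (x : CP3) (X Y Z : C3) :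
    HasDerivAt (fun t : ℝ => chartMetric x (t • X) Y Z)
      (-(inner ℂ (affineLin (adaptedBasis x) Y) (quatJ (affineLin (adaptedBasis x) X))
            * inner ℂ (quatJ (adaptedBasis x 0)) (affineLin (adaptedBasis x) Z)
          + inner ℂ (affineLin (adaptedBasis x) Y) (quatJ (adaptedBasis x 0))
            * inner ℂ (quatJ (affineLin (adaptedBasis x) X))
              (affineLin (adaptedBasis x) Z) : ℂ).re) 0 := by
  have e : ∀ r : ℝ, r ^ 4 = (r ^ 2) ^ 2 := fun r => by ring
  simp only [chartMetric_eq, nkMetric_mfderiv_hopf (affineVec_ne_zero _ _), e]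
  set b := adaptedBasis x
  have hv0 : affineVec b ((0 : ℝ) • X) = b 0 := by rw [zero_smul, affineVec_zero]
  have hn0 : ‖affineVec b ((0 : ℝ) • X)‖ ^ 2 ≠ 0 :=
    pow_ne_zero 2 (norm_ne_zero_iff.2 (affineVec_ne_zero b _))
  have hn := hasDerivAt_norm_sq_affineVec_smul b X
  have hv := hasDerivAt_affineVec_smul b X
  have hj := hasDerivAt_quatJ_affineVec_smul b X
  have hw := fun w : C4 => hasDerivAt_const (0 : ℝ) w
  have hvv := ((hw (affineLin b Y)).inner ℂ hv).fun_mul (hv.inner ℂ (hw (affineLin b Z)))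
  have hjj := ((hw (affineLin b Y)).inner ℂ hj).fun_mul (hj.inner ℂ (hw (affineLin b Z)))
  have hre : ∀ {φ : ℝ → ℂ} {φ' : ℂ}, HasDerivAt φ φ' 0 →
      HasDerivAt (fun t => (φ t).re) φ'.re 0 := fun h =>
    Complex.reCLM.hasFDerivAt.comp_hasDerivAt (0 : ℝ) h
  have h1 := (hasDerivAt_const (0 : ℝ) (inner ℂ (affineLin b Y) (affineLin b Z)).re).fun_div hn hn0
  have h2 := (hre hvv).fun_div (hn.fun_pow 2) (pow_ne_zero 2 hn0)
  have h3 := (hre hjj).fun_div (hn.fun_pow 2) (pow_ne_zero 2 hn0)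
  refine (((h1.fun_sub h2).const_mul 2).fun_sub h3).congr_deriv ?_
  simp only [hv0, b.orthonormal.1, inner_zero_affineLin, inner_affineLin_zero, inner_zero_left,
    inner_zero_right, mul_zero, zero_mul, add_zero, zero_add, sub_zero, sub_self, one_pow, mul_one,
    div_one, zero_sub, Complex.zero_re]

theorem fderiv_chartMetric (x : CP3) (X Y Z : C3) :
    fderiv ℝ (fun z => chartMetric x z Y Z) (chartAt C3 x x) X
      = -(inner ℂ (affineLin (adaptedBasis x) Y) (quatJ (affineLin (adaptedBasis x) X))
            * inner ℂ (quatJ (adaptedBasis x 0)) (affineLin (adaptedBasis x) Z)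
          + inner ℂ (affineLin (adaptedBasis x) Y) (quatJ (adaptedBasis x 0))
            * inner ℂ (quatJ (affineLin (adaptedBasis x) X))
              (affineLin (adaptedBasis x) Z) : ℂ).re := by
  rw [chartAt_self, ← (differentiableAt_chartMetric x 0 Y Z).lineDeriv_eq_fderiv]
  refine HasLineDerivAt.lineDeriv ?_
  simpa only [HasLineDerivAt, zero_add] using hasDerivAt_chartMetric_smul x X Y Z

theorem koszul_eq (x : CP3) (X Y Z : C3) :
    koszul x X Y Z = -2 * (inner ℂ
      (inner ℂ (quatJ (adaptedBasis x 0)) (affineLin (adaptedBasis x) Y)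
          • quatJ (affineLin (adaptedBasis x) X)
        + inner ℂ (quatJ (adaptedBasis x 0)) (affineLin (adaptedBasis x) X)
          • quatJ (affineLin (adaptedBasis x) Y))
      (affineLin (adaptedBasis x) Z) : ℂ).re := by
  have e : ∀ A B : C4, inner ℂ A (quatJ B) = conj (inner ℂ (quatJ B) A) := fun A B => by
    rw [inner_conj_symm]
  rw [koszul, fderiv_chartMetric, fderiv_chartMetric, fderiv_chartMetric]
  simp only [inner_add_left, inner_smul_left, e]
  rw [inner_quatJ_antisymm (affineLin (adaptedBasis x) Y) (affineLin (adaptedBasis x) X),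
    inner_quatJ_antisymm (affineLin (adaptedBasis x) Z) (affineLin (adaptedBasis x) X),
    inner_quatJ_antisymm (affineLin (adaptedBasis x) Z) (affineLin (adaptedBasis x) Y)]
  simp only [map_neg, Complex.add_re, Complex.mul_re, Complex.neg_re, Complex.neg_im,
    Complex.conj_re, Complex.conj_im]
  ring

theorem christoffel_eq (x : CP3) (X Y : TCP3 x) :
    christoffel x X Y = hopfPush x (-(1 / 2 : ℝ) •
      (inner ℂ (quatJ (adaptedBasis x 0)) (horLift x Y) • quatJ (horLift x X)
        + inner ℂ (quatJ (adaptedBasis x 0)) (horLift x X) • quatJ (horLift x Y))) := by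
  refine nkMetric_ext fun Z => ?_
  have h := ((exists_christoffel x X Y).choose_spec Z).trans (koszul_eq x X Y Z)
  change 2 * nkMetric x (christoffel x X Y) Z = _ at h
  rw [affineLin_eq_horLift, affineLin_eq_horLift, affineLin_eq_horLift] at h
  have h0 : ∀ A : TCP3 x, inner ℂ (quatJ (horLift x A)) (quatJ (adaptedBasis x 0)) = (0 : ℂ) :=
    fun A => by rw [inner_quatJ_quatJ, inner_horLift]
  rw [nkMetric_eq x (hopfPush x _), horLift_hopfPush]
  simp only [inner_sub_left, inner_smul_left_eq_smul, inner_add_left, inner_smul_left,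
    inner_horLift, h0, inner_quatJ_self, mul_zero, smul_zero, sub_zero, add_zero, zero_mul,
    Complex.smul_re, smul_eq_mul, Complex.zero_re] at h ⊢
  linear_combination h / 2

/-- The linear projection of `ℂ⁴` onto the affine coordinates of a unitary basis along its first
vector, a left inverse of `affineLin b`. -/
noncomputable def affineProj (b : UBasis) : C4 →L[ℝ] C3 :=
  ContinuousLinearMap.pi fun i => (innerSL ℂ (b i.succ)).restrictScalars ℝ

theorem hasFDerivAt_affineCoord_affineVec (b : UBasis) (z : C3) :
    HasFDerivAt (affineCoord b)
      (affineProj b - ((innerSL ℂ (b 0)).smulRight z).restrictScalars ℝ) (affineVec b z) := by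
  have hd : ∀ w v : C4, HasFDerivAt (fun v : C4 => (inner ℂ w v : ℂ)) (innerSL ℂ w) v :=
    fun w v => (innerSL ℂ w).hasFDerivAt
  rw [hasFDerivAt_pi']
  intro i
  have hinv := (hasDerivAt_inv (x := (inner ℂ (b 0) (affineVec b z) : ℂ))
    (by rw [inner_zero_affineVec]; exact one_ne_zero)).comp_hasFDerivAt _ (hd (b 0) _)
  simp only [affineCoord, div_eq_mul_inv]
  refine (((hd (b i.succ) _).mul hinv).restrictScalars ℝ).congr_fderiv ?_
  ext w
  simp only [inner_succ_affineVec, inner_zero_affineVec, one_pow, inv_one, Function.comp_apply,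
    one_smul, ContinuousLinearMap.restrictScalars_add, ContinuousLinearMap.restrictScalars_smul,
    neg_smul, smul_neg, add_apply, neg_apply, smul_apply,
    ContinuousLinearMap.coe_restrictScalars', coe_innerSL_apply, smul_eq_mul, affineProj,
    ContinuousLinearMap.comp_sub, ContinuousLinearMap.proj_pi, sub_apply,
    ContinuousLinearMap.comp_apply, ContinuousLinearMap.smulRight_apply,
    ContinuousLinearMap.proj_apply, Pi.smul_apply]
  ring

theorem mfderiv_chartAt_mfderiv_hopf (x : CP3) (z : C3) (u : C4) :
    mfderiv 𝓘(ℝ, C3) 𝓘(ℝ, C3) (chartAt C3 x) (hopf (affineVec (adaptedBasis x) z))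
      (mfderiv 𝓘(ℝ, C4) 𝓘(ℝ, C3) hopf (affineVec (adaptedBasis x) z) u)
      = affineProj (adaptedBasis x) u - inner ℂ (adaptedBasis x 0) u • z := by
  have hv := affineVec_ne_zero (adaptedBasis x) z
  have hsrc : hopf (affineVec (adaptedBasis x) z) ∈ (chartAt C3 x).source :=
    (chartAt C3 x).map_target (Set.mem_univ z)
  have hchart :=
    (mdifferentiableAt_atlas (I := 𝓘(ℝ, C3)) (chart_mem_atlas C3 x) hsrc).hasMFDerivAt
  have hcomp := (hasFDerivAt_affineCoord_affineVec (adaptedBasis x) z).hasMFDerivAt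
    |>.congr_of_eventuallyEq (f₁ := chartAt C3 x ∘ hopf) <| by
      filter_upwards [isOpen_ne.mem_nhds hv] with w hw
      obtain ⟨a, ha, hr⟩ := exists_smul_rep hw
      change affineCoord (adaptedBasis x) (hopf w).rep = _
      rw [hr, affineCoord_smul _ ha]
  rw [(hasMFDerivAt_hopf hv).mfderiv]
  exact congrArg (fun l : C4 →L[ℝ] C3 => l u)
    ((hchart.comp _ (hasMFDerivAt_hopf hv)).mfderiv.symm.trans hcomp.mfderiv)

/-- A vector at `affineVec (adaptedBasis x) z` which the Hopf fibration maps to `JY`, where `Y`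
stands for the tangent vector with coordinates `Y` in the chart centred at `x`. -/
noncomputable def chartJVec (x : CP3) (Y z : C3) : C4 :=
  Complex.I • affineLin (adaptedBasis x) Y -
    (2 * Complex.I * inner ℂ (quatJ (affineVec (adaptedBasis x) z)) (affineLin (adaptedBasis x) Y)
      / (‖affineVec (adaptedBasis x) z‖ ^ 2 : ℝ)) • quatJ (affineVec (adaptedBasis x) z)

theorem chartJ_eq (x : CP3) (z Y : C3) :
    chartJ x z Y = affineProj (adaptedBasis x) (chartJVec x Y z)
      - inner ℂ (adaptedBasis x 0) (chartJVec x Y z) • z := by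
  have hv := affineVec_ne_zero (adaptedBasis x) z
  refine Eq.trans ?_ (mfderiv_chartAt_mfderiv_hopf x z _)
  rw [chartJVec, mfderiv_hopf_eq_hopfPushAt hv, ← nkJ_hopfPushAt hv rfl,
    ← mfderiv_hopf_eq_hopfPushAt hv, ← mfderiv_chart_symm]
  rfl

theorem differentiable_chartJVec (x : CP3) (Y : C3) : Differentiable ℝ (chartJVec x Y) := by
  have hv : Differentiable ℝ (affineVec (adaptedBasis x)) := fun z =>
    (hasFDerivAt_affineVec _ z).differentiableAt
  have hj : Differentiable ℝ (fun z => quatJ (affineVec (adaptedBasis x) z)) :=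
    (LinearMap.toContinuousLinearMap quatJ).differentiable.comp hv
  have hn : ∀ z : C3, ((‖affineVec (adaptedBasis x) z‖ ^ 2 : ℝ) : ℂ)
      = inner ℂ (affineVec (adaptedBasis x) z) (affineVec (adaptedBasis x) z) := fun z => by
    rw [inner_self_eq_norm_sq_to_K]
    norm_cast
  unfold chartJVec
  simp only [hn, div_eq_mul_inv]
  exact ((((hj.inner ℂ (differentiable_const _)).const_mul _).fun_mul
    ((hv.inner ℂ hv).inv fun z => inner_self_ne_zero.2 (affineVec_ne_zero _ z))).fun_smul
    hj).const_sub _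

theorem hasDerivAt_chartJVec_smul (x : CP3) (X Y : C3) :
    HasDerivAt (fun t : ℝ => chartJVec x Y (t • X)) (-(2 * Complex.I) •
      (inner ℂ (quatJ (affineLin (adaptedBasis x) X)) (affineLin (adaptedBasis x) Y)
          • quatJ (adaptedBasis x 0)
        + inner ℂ (quatJ (adaptedBasis x 0)) (affineLin (adaptedBasis x) Y)
          • quatJ (affineLin (adaptedBasis x) X))) 0 := by
  have hv0 : affineVec (adaptedBasis x) ((0 : ℝ) • X) = adaptedBasis x 0 := by
    rw [zero_smul, affineVec_zero]
  have hj := hasDerivAt_quatJ_affineVec_smul (adaptedBasis x) X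
  have hc := (((hj.inner ℂ (hasDerivAt_const (0 : ℝ) (affineLin (adaptedBasis x) Y))).const_mul
    (2 * Complex.I)).fun_div (hasDerivAt_norm_sq_affineVec_smul (adaptedBasis x) X).ofReal_comp
    (by rw [norm_sq_affineVec_smul]; simp)).fun_smul hj
  refine (hc.const_sub (Complex.I • affineLin (adaptedBasis x) Y)).congr_deriv ?_
  simp only [hv0, (adaptedBasis x).orthonormal.1]
  simp only [one_pow, Complex.ofReal_one, div_one, inner_zero_right, zero_add, mul_one,
    Complex.ofReal_zero, mul_zero, sub_zero, neg_add_rev, smul_add, neg_smul]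
  module

theorem fderiv_chartJVec (x : CP3) (X Y : C3) :
    fderiv ℝ (chartJVec x Y) 0 X = -(2 * Complex.I) •
      (inner ℂ (quatJ (affineLin (adaptedBasis x) X)) (affineLin (adaptedBasis x) Y)
          • quatJ (adaptedBasis x 0)
        + inner ℂ (quatJ (adaptedBasis x 0)) (affineLin (adaptedBasis x) Y)
          • quatJ (affineLin (adaptedBasis x) X)) := by
  rw [← (differentiable_chartJVec x Y 0).lineDeriv_eq_fderiv]
  refine HasLineDerivAt.lineDeriv ?_
  simpa only [HasLineDerivAt, zero_add] using hasDerivAt_chartJVec_smul x X Y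

theorem fderiv_chartJ (x : CP3) (X Y : C3) :
    fderiv ℝ (fun z => chartJ x z Y) (chartAt C3 x x) X
      = affineProj (adaptedBasis x) (fderiv ℝ (chartJVec x Y) 0 X) := by
  have hc0 : inner ℂ (adaptedBasis x 0) (chartJVec x Y 0) = 0 := by
    simp only [chartJVec, affineVec_zero, inner_sub_right, inner_smul_right, inner_zero_affineLin,
      inner_quatJ_self, mul_zero, sub_self]
  have hN := (differentiable_chartJVec x Y 0).hasFDerivAt
  have hcoef := ((innerSL ℂ (adaptedBasis x 0)).restrictScalars ℝ).hasFDerivAt.comp 0 hN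
  have h := ((affineProj (adaptedBasis x)).hasFDerivAt.comp (0 : C3) hN).fun_sub
    (hcoef.fun_smul (hasFDerivAt_id (𝕜 := ℝ) (0 : C3)))
  rw [chartAt_self]
  simp only [chartJ_eq]
  refine (congrArg (fun l : C3 →L[ℝ] C3 => l X) h.fderiv).trans ?_
  simp [hc0]

theorem nkJ_hopfPush (x : CP3) (w : C4) : nkJ x (hopfPush x w) = hopfPush x (Complex.I • w -
    (2 * Complex.I * inner ℂ (quatJ (adaptedBasis x 0)) w) • quatJ (adaptedBasis x 0)) := by
  have h := nkJ_hopfPushAt (UBasis.ne_zero _ 0) (hopf_adaptedBasis x) w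
  rw [hopfPushAt_adaptedBasis, hopfPushAt_adaptedBasis, (adaptedBasis x).orthonormal.1] at h
  simpa using h

theorem horLift_nkJ (x : CP3) (Y : TCP3 x) : horLift x (nkJ x Y) = Complex.I • horLift x Y -
    (2 * Complex.I * inner ℂ (quatJ (adaptedBasis x 0)) (horLift x Y)) •
      quatJ (adaptedBasis x 0) := by
  conv_lhs => rw [← hopfPush_horLift x Y]
  rw [nkJ_hopfPush, horLift_hopfPush, inner_sub_right, inner_smul_right, inner_smul_right,
    inner_horLift, inner_quatJ_self]
  simp

theorem nablaJ_eq (x : CP3) (X Y : TCP3 x) :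
    nablaJ x X Y = hopfPush x (
      -(2 * Complex.I * inner ℂ (quatJ (horLift x X)) (horLift x Y)) • quatJ (adaptedBasis x 0)
      + (Complex.I * inner ℂ (quatJ (adaptedBasis x 0)) (horLift x X)) • quatJ (horLift x Y)
      - (Complex.I * inner ℂ (quatJ (adaptedBasis x 0)) (horLift x Y)) • quatJ (horLift x X)) := by
  have hDJ := (fderiv_chartJ x X Y).trans
    (congrArg (affineProj (adaptedBasis x)) (fderiv_chartJVec x X Y))
  rw [affineLin_eq_horLift, affineLin_eq_horLift] at hDJ
  have h0 : ∀ A : TCP3 x, inner ℂ (quatJ (adaptedBasis x 0)) (quatJ (horLift x A)) = (0 : ℂ) :=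
    fun A => by rw [inner_quatJ_quatJ, ← inner_conj_symm, inner_horLift, map_zero]
  have hG : nablaJ x X Y = hopfPush x (-(2 * Complex.I) •
      (inner ℂ (quatJ (horLift x X)) (horLift x Y) • quatJ (adaptedBasis x 0)
        + inner ℂ (quatJ (adaptedBasis x 0)) (horLift x Y) • quatJ (horLift x X)))
      + christoffel x X (nkJ x Y) - nkJ x (christoffel x X Y) :=
    congrArg (fun D : TCP3 x => D + christoffel x X (nkJ x Y) - nkJ x (christoffel x X Y)) hDJ
  rw [hG, christoffel_eq, christoffel_eq, nkJ_hopfPush, horLift_nkJ, ← map_add, ← map_sub,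
    ← sub_eq_zero, ← map_sub]
  simp only [inner_smul_right_eq_smul, inner_add_right, inner_sub_right, h0,
    norm_quatJ_adaptedBasis, map_sub quatJ, quatJ_smul, quatJ_quatJ]
  refine (congrArg (hopfPush x) ?_).trans (hopfPush_smul_adaptedBasis x (Complex.I *
    inner ℂ (quatJ (adaptedBasis x 0)) (horLift x X) *
      conj (inner ℂ (quatJ (adaptedBasis x 0)) (horLift x Y))))
  generalize inner ℂ (quatJ (adaptedBasis x 0)) (horLift x Y) = a
  generalize inner ℂ (quatJ (adaptedBasis x 0)) (horLift x X) = b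
  generalize inner ℂ (quatJ (horLift x X)) (horLift x Y) = c
  simp only [← Complex.coe_smul, smul_eq_mul, map_mul, Complex.conj_I, Complex.conj_ofNat,
    mul_zero, add_zero, mul_one]
  push_cast
  module

theorem nablaJ_hopfPushAt {x : CP3} {v w w' : C4} (hv : ‖v‖ = 1) (hx : hopf v = x)
    (hw : inner ℂ v w = 0) (hw' : inner ℂ v w' = 0) :
    nablaJ x (hopfPushAt x v w) (hopfPushAt x v w') = hopfPushAt x v (
      -(2 * Complex.I * inner ℂ (quatJ w) w') • quatJ v
      + (Complex.I * inner ℂ (quatJ v) w) • quatJ w'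
      - (Complex.I * inner ℂ (quatJ v) w') • quatJ w) := by
  obtain ⟨d, hd, rfl, h⟩ :=
    exists_eq_smul_adaptedBasis (norm_ne_zero_iff.1 (hv.trans_ne one_ne_zero)) hx
  have hd1 : ‖d‖ = 1 := by rwa [norm_smul, (adaptedBasis x).orthonormal.1, mul_one] at hv
  have hdd : conj d = d⁻¹ := (Complex.inv_eq_conj hd1).symm
  have hl : ∀ w, inner ℂ (d • adaptedBasis x 0) w = 0 →
      horLift x (hopfPush x (d⁻¹ • w)) = d⁻¹ • w := by
    intro w hw
    rw [inner_smul_left] at hw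
    rw [horLift_hopfPush, inner_smul_right,
      (mul_eq_zero.1 hw).resolve_left ((map_ne_zero _).2 hd), mul_zero, zero_smul, sub_zero]
  rw [h, h, h, nablaJ_eq, hl w hw, hl w' hw']
  congr 1
  simp only [quatJ_smul, inner_smul_left, inner_smul_right, map_inv₀, hdd, inv_inv, smul_sub,
    smul_add, smul_smul]
  match_scalars <;> field_simp

/-! ### Unitary coordinates on the tangent spaces -/

/-- A unitary basis of `ℂ⁴ = ℍ²` consisting of two quaternionic lines `span {e, je}`. -/
structure IsQuaternionicBasis (e : UBasis) : Prop where
  apply_one : e 1 = quatJ (e 0)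
  apply_three : e 3 = quatJ (e 2)

theorem orthonormal_quatJ_pair {v w : C4} (hv : ‖v‖ = 1) (hw : ‖w‖ = 1) (hvw : inner ℂ v w = 0)
    (hjvw : inner ℂ (quatJ v) w = 0) : Orthonormal ℂ ![v, quatJ v, w, quatJ w] := by
  have hwv : inner ℂ w v = 0 := by rw [← inner_conj_symm, hvw, map_zero]
  have hwjv : inner ℂ w (quatJ v) = 0 := by rw [← inner_conj_symm, hjvw, map_zero]
  have hjwv : inner ℂ (quatJ w) v = 0 := by rw [inner_quatJ_antisymm, hjvw, neg_zero]
  have hvjw : inner ℂ v (quatJ w) = 0 := by rw [← inner_conj_symm, hjwv, map_zero]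
  refine ⟨fun i => ?_, fun i j hij => ?_⟩
  · fin_cases i <;> simp [hv, hw, norm_quatJ]
  · fin_cases i <;> fin_cases j <;>
      simp_all [inner_quatJ_self, inner_quatJ_self', inner_quatJ_quatJ]

theorem exists_isQuaternionicBasis {v : C4} (hv : ‖v‖ = 1) :
    ∃ e : UBasis, IsQuaternionicBasis e ∧ e 0 = v := by
  obtain ⟨b, hb⟩ := Orthonormal.exists_orthonormalBasis_extension_of_card_eq (𝕜 := ℂ)
    (E := C4) (ι := Fin 4) (by simp) (v := ![v, quatJ v, 0, 0]) (s := {0, 1}) (by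
      refine ⟨?_, ?_⟩
      · rintro ⟨i, hi | hi⟩ <;> subst hi <;> simp [hv, norm_quatJ]
      · rintro ⟨i, hi | hi⟩ ⟨j, hj | hj⟩ hij <;> subst hi <;> subst hj <;>
          simp_all [inner_quatJ_self, inner_quatJ_self'])
  have h0 : b 0 = v := hb 0 (by simp)
  have h1 : b 1 = quatJ v := hb 1 (by simp)
  have h02 : inner ℂ v (b 2) = 0 := h0 ▸ b.orthonormal.2 (by decide)
  have h12 : inner ℂ (quatJ v) (b 2) = 0 := h1 ▸ b.orthonormal.2 (by decide)
  have ho := orthonormal_quatJ_pair hv (b.orthonormal.1 2) h02 h12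
  refine ⟨OrthonormalBasis.mk ho
    (ho.linearIndependent.span_eq_top_of_card_eq_finrank (by simp)).ge, ⟨?_, ?_⟩, ?_⟩
  all_goals simp

/-- The cross product of `ℂ³` compatible with its Hermitian inner product,
`(a, b) ↦ i · conj (a × b)`: this is the tensor `G` of the nearly Kähler `ℂP³` in suitable unitary
coordinates. -/
noncomputable def hermCross (a b : EuclideanSpace ℂ (Fin 3)) : EuclideanSpace ℂ (Fin 3) :=
  !₂[Complex.I * conj (a 1 * b 2 - a 2 * b 1), Complex.I * conj (a 2 * b 0 - a 0 * b 2),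
    Complex.I * conj (a 0 * b 1 - a 1 * b 0)]

/-- Real linear unitary coordinates on the tangent space of the nearly Kähler `ℂP³` at `x`, whose
first coordinate is the component along `D₁`. -/
structure IsUnitaryCoord (x : CP3) (φ : TCP3 x →ₗ[ℝ] EuclideanSpace ℂ (Fin 3)) : Prop where
  nkMetric_eq : ∀ X Y, nkMetric x X Y = (inner ℂ (φ X) (φ Y)).re
  map_nkJ : ∀ X, φ (nkJ x X) = Complex.I • φ X
  map_kahlerJ : ∀ X,
    φ (kahlerJ x X) = !₂[-Complex.I * φ X 0, Complex.I * φ X 1, Complex.I * φ X 2]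
  map_nablaJ : ∀ X Y, φ (nablaJ x X Y) = hermCross (φ X) (φ Y)

/-- The coordinates on the orthogonal complement of `e 0`, for a quaternionic basis `e`, from which
unitary coordinates on the tangent space at `hopf (e 0)` are obtained. The first one is conjugated
since `J = -J∘` on `D₁`; the factors `√2` come from `g`, which is `g∘` on `D₁` and `2 g∘` on
`D₂`. -/
noncomputable def quatCoord (e : UBasis) : C4 →ₗ[ℝ] EuclideanSpace ℂ (Fin 3) where
  toFun w := !₂[conj (inner ℂ (e 1) w), √2 * inner ℂ (e 2) w, √2 * inner ℂ (e 3) w]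
  map_add' w w' := by ext i; fin_cases i <;> simp [mul_add]
  map_smul' c w := by ext i; fin_cases i <;> simp [mul_left_comm]

theorem quatCoord_apply (e : UBasis) (w : C4) : quatCoord e w =
    !₂[conj (inner ℂ (e 1) w), √2 * inner ℂ (e 2) w, √2 * inner ℂ (e 3) w] := rfl

theorem quatCoord_smul (e : UBasis) (c : ℂ) (w : C4) : quatCoord e (c • w) =
    !₂[conj c * quatCoord e w 0, c * quatCoord e w 1, c * quatCoord e w 2] := by
  ext i
  fin_cases i <;> simp [quatCoord_apply, mul_left_comm, -inner_conj_symm]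

theorem quatCoord_apply_zero (e : UBasis) : quatCoord e (e 0) = 0 := by
  have h : ∀ i ≠ 0, inner ℂ (e i) (e 0) = 0 := fun i hi => e.orthonormal.2 hi
  ext i
  fin_cases i <;> simp [quatCoord_apply, h]

theorem quatCoord_apply_one (e : UBasis) :
    quatCoord e (e 1) = EuclideanSpace.single (0 : Fin 3) (1 : ℂ) := by
  have h : ∀ i ≠ 1, inner ℂ (e i) (e 1) = 0 := fun i hi => e.orthonormal.2 hi
  ext i
  fin_cases i <;> simp [quatCoord_apply, h]

theorem re_inner_quatCoord (e : UBasis) {w : C4} (hw : inner ℂ (e 0) w = 0) (w' : C4) :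
    (inner ℂ (quatCoord e w) (quatCoord e w')).re =
      2 * (inner ℂ w w').re - (inner ℂ w (e 1) * inner ℂ (e 1) w').re := by
  have hsq : √2 * √2 = 2 := Real.mul_self_sqrt zero_le_two
  simp only [← e.sum_inner_mul_inner w w', ← inner_conj_symm w, Fin.sum_univ_four, hw,
    quatCoord_apply]
  generalize inner ℂ (e 1) w = a₁, inner ℂ (e 2) w = a₂, inner ℂ (e 3) w = a₃,
    inner ℂ (e 1) w' = b₁, inner ℂ (e 2) w' = b₂, inner ℂ (e 3) w' = b₃
  simp only [PiLp.inner_apply, RCLike.inner_apply, Fin.sum_univ_three, Matrix.cons_val,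
    Complex.add_re, Complex.mul_re, Complex.conj_re, Complex.conj_im, Complex.ofReal_im, zero_mul,
    Complex.mul_im, map_zero, zero_add]
  linear_combination (a₂.re * b₂.re + a₂.im * b₂.im + a₃.re * b₃.re + a₃.im * b₃.im) * hsq

theorem quatCoord_nkJ (e : UBasis) (w : C4) :
    quatCoord e (Complex.I • w - (2 * Complex.I * inner ℂ (e 1) w) • e 1) =
      Complex.I • quatCoord e w := by
  rw [map_sub, quatCoord_smul, quatCoord_smul, quatCoord_apply_one]
  ext i
  fin_cases i
  · simp only [Complex.conj_I, quatCoord_apply, Matrix.cons_val, map_mul, Complex.conj_ofNat,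
      PiLp.single_eq_same, Fin.zero_eta, PiLp.sub_apply, PiLp.smul_apply]
    ring
  · simp
  · simp

section Quaternionic

variable {e : UBasis}

theorem inner_apply_two_quatJ (he : IsQuaternionicBasis e) (w : C4) :
    inner ℂ (e 2) (quatJ w) = -conj (inner ℂ (e 3) w) := by
  rw [inner_conj_symm, he.apply_three, ← inner_quatJ_quatJ, quatJ_quatJ, inner_neg_left]

theorem inner_apply_three_quatJ (he : IsQuaternionicBasis e) (w : C4) :
    inner ℂ (e 3) (quatJ w) = conj (inner ℂ (e 2) w) := by
  rw [inner_conj_symm, he.apply_three, inner_quatJ_quatJ]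

theorem inner_apply_one_quatJ (he : IsQuaternionicBasis e) (w : C4) :
    inner ℂ (e 1) (quatJ w) = conj (inner ℂ (e 0) w) := by
  rw [inner_conj_symm, he.apply_one, inner_quatJ_quatJ]

theorem quatCoord_quatJ (he : IsQuaternionicBasis e) {w : C4} (hw : inner ℂ (e 0) w = 0) :
    quatCoord e (quatJ w) = !₂[0, -conj (quatCoord e w 2), conj (quatCoord e w 1)] := by
  ext i
  fin_cases i <;> simp [quatCoord_apply, inner_apply_one_quatJ he, inner_apply_two_quatJ he,
    inner_apply_three_quatJ he, hw, -inner_conj_symm]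

theorem two_mul_inner_quatJ (he : IsQuaternionicBasis e) {w w' : C4}
    (hw : inner ℂ (e 0) w = 0) (hw' : inner ℂ (e 0) w' = 0) :
    2 * inner ℂ (quatJ w) w' =
      quatCoord e w 1 * quatCoord e w' 2 - quatCoord e w 2 * quatCoord e w' 1 := by
  have hsq : (√2 : ℂ) * √2 = 2 := by
    rw [← Complex.ofReal_mul, Real.mul_self_sqrt zero_le_two, Complex.ofReal_ofNat]
  rw [← e.sum_inner_mul_inner, Fin.sum_univ_four, hw', ← inner_conj_symm _ (e 1),
    inner_apply_one_quatJ he, hw, ← inner_conj_symm _ (e 2), inner_apply_two_quatJ he,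
    ← inner_conj_symm _ (e 3), inner_apply_three_quatJ he]
  simp only [map_neg, RingHomCompTriple.comp_apply, RingHom.id_apply, quatCoord_apply,
    Matrix.cons_val]
  linear_combination (inner ℂ (e 3) w * inner ℂ (e 2) w' - inner ℂ (e 2) w * inner ℂ (e 3) w') * hsq

theorem quatCoord_nablaJ (he : IsQuaternionicBasis e) {w w' : C4} (hw : inner ℂ (e 0) w = 0)
    (hw' : inner ℂ (e 0) w' = 0) :
    quatCoord e (-(2 * Complex.I * inner ℂ (quatJ w) w') • e 1
        + (Complex.I * inner ℂ (e 1) w) • quatJ w' - (Complex.I * inner ℂ (e 1) w') • quatJ w) =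
      hermCross (quatCoord e w) (quatCoord e w') := by
  have h0 : ∀ w, inner ℂ (e 1) w = conj (quatCoord e w 0) := fun w => by
    simp [quatCoord_apply]
  rw [map_sub, map_add, quatCoord_smul, quatCoord_smul, quatCoord_smul, quatCoord_apply_one,
    quatCoord_quatJ he hw, quatCoord_quatJ he hw', h0, h0, hermCross,
    ← two_mul_inner_quatJ he hw hw']
  ext i
  fin_cases i
  · simp only [map_neg, map_mul, Complex.conj_I, PiLp.single_eq_same, Matrix.cons_val, Fin.zero_eta,
      PiLp.sub_apply, PiLp.add_apply]
    ring
  · simp only [map_mul, ne_eq, not_false_eq_true, PiLp.single_eq_of_ne, Fin.reduceEq,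
      Matrix.cons_val, Fin.mk_one, PiLp.sub_apply, PiLp.add_apply, map_sub]
    ring
  · simp only [map_mul, ne_eq, not_false_eq_true, PiLp.single_eq_of_ne, Fin.reduceEq,
      Matrix.cons_val, Fin.reduceFinMk, PiLp.sub_apply, PiLp.add_apply, map_sub]
    ring

end Quaternionic

theorem exists_linearMap_comp_hopfPushAt {F : Type*} [AddCommGroup F] [Module ℝ F] {x : CP3}
    {v : C4} (hv : v ≠ 0) (hx : hopf v = x) (ψ : C4 →ₗ[ℝ] F) (hψ : ∀ c : ℂ, ψ (c • v) = 0) :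
    ∃ φ : TCP3 x →ₗ[ℝ] F, ∀ w, φ (hopfPushAt x v w) = ψ w := by
  obtain ⟨d, hd, rfl, h⟩ := exists_eq_smul_adaptedBasis hv hx
  refine ⟨ψ ∘ₗ (d • (LinearMap.id : C4 →ₗ[ℂ] C4)).restrictScalars ℝ ∘ₗ horLift x, fun w => ?_⟩
  change ψ (d • horLift x (hopfPushAt x _ w)) = ψ w
  rw [h, horLift_hopfPush, smul_sub, smul_inv_smul₀ hd, smul_comm, map_sub, hψ, sub_zero]

theorem exists_isUnitaryCoord_of_norm_eq_one {x : CP3} {v : C4} (hv : ‖v‖ = 1) (hx : hopf v = x) :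
    ∃ φ, IsUnitaryCoord x φ ∧ ∀ w, φ (hopfPushAt x v w) 0 = conj (inner ℂ (quatJ v) w) := by
  have hv0 : v ≠ 0 := norm_ne_zero_iff.1 (hv.trans_ne one_ne_zero)
  obtain ⟨e, he, rfl⟩ := exists_isQuaternionicBasis hv
  obtain ⟨φ, hφ⟩ := exists_linearMap_comp_hopfPushAt hv0 hx (quatCoord e) fun c => by
    rw [quatCoord_smul, quatCoord_apply_zero]
    ext i
    fin_cases i <;> simp
  refine ⟨φ, ⟨fun X Y => ?_, fun X => ?_, fun X => ?_, fun X Y => ?_⟩, fun w => ?_⟩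
  · obtain ⟨w, hw, rfl⟩ := exists_hopfPushAt_eq hv0 hx X
    obtain ⟨w', hw', rfl⟩ := exists_hopfPushAt_eq hv0 hx Y
    rw [nkMetric_hopfPushAt hv hx, hφ, hφ, re_inner_quatCoord e hw, he.apply_one, hw', mul_zero,
      sub_zero]
  · obtain ⟨w, -, rfl⟩ := exists_hopfPushAt_eq hv0 hx X
    rw [nkJ_hopfPushAt hv0 hx, hφ, hφ, hv, ← he.apply_one, ← quatCoord_nkJ]
    norm_num
  · obtain ⟨w, -, rfl⟩ := exists_hopfPushAt_eq hv0 hx X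
    rw [kahlerJ_hopfPushAt hv0 hx, hφ, hφ, quatCoord_smul, Complex.conj_I]
  · obtain ⟨w, hw, rfl⟩ := exists_hopfPushAt_eq hv0 hx X
    obtain ⟨w', hw', rfl⟩ := exists_hopfPushAt_eq hv0 hx Y
    rw [nablaJ_hopfPushAt hv hx hw hw', hφ, hφ, hφ, ← he.apply_one, quatCoord_nablaJ he hw hw']
  · rw [hφ, ← he.apply_one]
    rfl

theorem exists_isUnitaryCoord (x : CP3) : ∃ φ, IsUnitaryCoord x φ :=
  (exists_isUnitaryCoord_of_norm_eq_one ((adaptedBasis x).orthonormal.1 0)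
    (hopf_adaptedBasis x)).imp fun _ => And.left

/-! ### Totally real planes -/

theorem inner_left_hermCross (a b : EuclideanSpace ℂ (Fin 3)) : inner ℂ a (hermCross a b) = 0 := by
  simp only [hermCross, map_sub, map_mul, PiLp.inner_apply, RCLike.inner_apply, Fin.sum_univ_three,
    Matrix.cons_val]
  ring

theorem inner_right_hermCross (a b : EuclideanSpace ℂ (Fin 3)) : inner ℂ b (hermCross a b) = 0 := by
  simp only [hermCross, map_sub, map_mul, PiLp.inner_apply, RCLike.inner_apply, Fin.sum_univ_three,
    Matrix.cons_val]
  ring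

theorem inner_hermCross_hermCross (a b c d : EuclideanSpace ℂ (Fin 3)) :
    inner ℂ (hermCross a b) (hermCross c d) =
      inner ℂ c a * inner ℂ d b - inner ℂ d a * inner ℂ c b := by
  simp only [hermCross, map_sub, map_mul, PiLp.inner_apply, RCLike.inner_apply, Fin.sum_univ_three,
    Complex.conj_I, RingHomCompTriple.comp_apply, RingHom.id_apply, Matrix.cons_val]
  ring_nf
  simp only [Complex.I_sq]
  ring

theorem orthonormal_hermCross {a b : EuclideanSpace ℂ (Fin 3)} (h : Orthonormal ℂ ![a, b]) :
    Orthonormal ℂ ![a, b, hermCross a b] := by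
  have ha : ‖a‖ = 1 := h.1 0
  have hb : ‖b‖ = 1 := h.1 1
  have hab : inner ℂ a b = 0 := h.2 (show (0 : Fin 2) ≠ 1 by decide)
  have hba : inner ℂ b a = 0 := h.2 (show (1 : Fin 2) ≠ 0 by decide)
  have hc : ‖hermCross a b‖ = 1 := by
    rw [← pow_eq_one_iff_of_nonneg (norm_nonneg _) two_ne_zero, ← inner_self_eq_norm_sq (𝕜 := ℂ),
      inner_hermCross_hermCross, inner_self_eq_norm_sq_to_K, inner_self_eq_norm_sq_to_K, ha, hb,
      hab]
    simp
  have hca := inner_eq_zero_symm.1 (inner_left_hermCross a b)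
  have hcb := inner_eq_zero_symm.1 (inner_right_hermCross a b)
  refine ⟨fun i => ?_, fun i j hij => ?_⟩
  · fin_cases i <;> simp [ha, hb, hc]
  · fin_cases i <;> fin_cases j <;>
      simp_all [inner_left_hermCross, inner_right_hermCross]

section Linear

variable {x : CP3}

theorem kahlerJ_add (X Y : TCP3 x) : kahlerJ x (X + Y) = kahlerJ x X + kahlerJ x Y := by
  rw [kahlerJ, map_add, smul_add, map_add]
  rfl

theorem kahlerJ_smul (c : ℝ) (X : TCP3 x) : kahlerJ x (c • X) = c • kahlerJ x X := by
  rw [kahlerJ, map_smul (horLift x), smul_comm, map_smul]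
  rfl

theorem almostProd_almostProd (X : TCP3 x) : almostProd x (almostProd x X) = X := by
  have h : horLift x (almostProd x X) = horLift x X -
      (2 * inner ℂ (quatJ (adaptedBasis x 0)) (horLift x X)) • quatJ (adaptedBasis x 0) := by
    rw [almostProd, map_sub, map_sub, hopfPush_horLift, horLift_hopfPush_quatJ]
  rw [almostProd, h, inner_sub_right, inner_smul_right, norm_quatJ_adaptedBasis, mul_one, two_mul,
    sub_add_cancel_left, mul_neg, neg_smul, sub_neg_eq_add, ← two_mul, sub_add_cancel,
    hopfPush_horLift]

theorem four_mul_fubiniStudy_kahlerJ (X Y : TCP3 x) :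
    4 * fubiniStudy x X (kahlerJ x Y) =
      3 * nkMetric x X (kahlerJ x Y) - nkMetric x X (nkJ x Y) := by
  rw [nkMetric, nkMetric, nkJ, almostProd_almostProd]
  ring

theorem nkMetric_add_left (X X' Y : TCP3 x) :
    nkMetric x (X + X') Y = nkMetric x X Y + nkMetric x X' Y :=
  (nkForm x).map_add₂ X X' Y

theorem nkMetric_smul_left (c : ℝ) (X Y : TCP3 x) :
    nkMetric x (c • X) Y = c * nkMetric x X Y :=
  (nkForm x).map_smul₂ c X Y

theorem nkMetric_add_right (X Y Y' : TCP3 x) :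
    nkMetric x X (Y + Y') = nkMetric x X Y + nkMetric x X Y' :=
  (nkForm x X).map_add Y Y'

theorem nkMetric_smul_right (c : ℝ) (X Y : TCP3 x) :
    nkMetric x X (c • Y) = c * nkMetric x X Y :=
  (nkForm x X).map_smul c Y

theorem nkMetric_comm (X Y : TCP3 x) : nkMetric x X Y = nkMetric x Y X := by
  obtain ⟨φ, hφ⟩ := exists_isUnitaryCoord x
  rw [hφ.nkMetric_eq, hφ.nkMetric_eq, ← inner_conj_symm, Complex.conj_re]

theorem IsUnitaryCoord.injective {φ : TCP3 x →ₗ[ℝ] EuclideanSpace ℂ (Fin 3)}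
    (hφ : IsUnitaryCoord x φ) : Function.Injective φ := by
  refine (injective_iff_map_eq_zero φ).2 fun X hX => of_not_not fun h => (nkMetric_pos x h).ne' ?_
  rw [hφ.nkMetric_eq, hX, inner_zero_left, Complex.zero_re]

theorem IsUnitaryCoord.inner_map_map {φ : TCP3 x →ₗ[ℝ] EuclideanSpace ℂ (Fin 3)}
    (hφ : IsUnitaryCoord x φ) (X Y : TCP3 x) :
    inner ℂ (φ X) (φ Y) = nkMetric x X Y - nkMetric x X (nkJ x Y) * Complex.I := by
  apply Complex.ext
  · simp [hφ.nkMetric_eq]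
  · simp [hφ.nkMetric_eq, hφ.map_nkJ]

theorem IsUnitaryCoord.inner_map_kahlerJ {φ : TCP3 x →ₗ[ℝ] EuclideanSpace ℂ (Fin 3)}
    (hφ : IsUnitaryCoord x φ) (a : EuclideanSpace ℂ (Fin 3)) (X : TCP3 x) :
    inner ℂ a (φ (kahlerJ x X)) =
      Complex.I * (inner ℂ a (φ X) - 2 * (conj (a 0) * φ X 0)) := by
  simp only [hφ.map_kahlerJ, PiLp.inner_apply, RCLike.inner_apply, Fin.sum_univ_three,
    Matrix.cons_val]
  ring

theorem IsUnitaryCoord.nkMetric_kahlerJ {φ : TCP3 x →ₗ[ℝ] EuclideanSpace ℂ (Fin 3)}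
    (hφ : IsUnitaryCoord x φ) (X Y : TCP3 x) :
    nkMetric x X (kahlerJ x Y) = nkMetric x X (nkJ x Y) + 2 * (conj (φ X 0) * φ Y 0).im := by
  rw [hφ.nkMetric_eq, hφ.inner_map_kahlerJ, hφ.inner_map_map, Complex.I_mul_re]
  simp only [Complex.sub_im, Complex.ofReal_im, Complex.mul_im, Complex.ofReal_re, Complex.I_im,
    Complex.re_ofNat, Complex.im_ofNat]
  ring

theorem nkMetric_kahlerJ_antisymm (X Y : TCP3 x) :
    nkMetric x X (kahlerJ x Y) = -nkMetric x Y (kahlerJ x X) := by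
  obtain ⟨φ, hφ⟩ := exists_isUnitaryCoord x
  rw [hφ.nkMetric_eq, hφ.nkMetric_eq, hφ.map_kahlerJ, hφ.map_kahlerJ]
  simp only [PiLp.inner_apply, RCLike.inner_apply, Fin.sum_univ_three, Matrix.cons_val,
    Complex.add_re, Complex.neg_re, Complex.mul_re, Complex.I_re, Complex.conj_re, Complex.mul_im,
    Complex.conj_im]
  ring

theorem nkMetric_kahlerJ_self (X : TCP3 x) : nkMetric x X (kahlerJ x X) = 0 :=
  self_eq_neg.1 (nkMetric_kahlerJ_antisymm X X)

theorem nkMetric_kahlerJ_kahlerJ (X Y : TCP3 x) :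
    nkMetric x (kahlerJ x X) (kahlerJ x Y) = nkMetric x X Y := by
  obtain ⟨φ, hφ⟩ := exists_isUnitaryCoord x
  rw [hφ.nkMetric_eq, hφ.nkMetric_eq, hφ.map_kahlerJ, hφ.map_kahlerJ]
  simp [PiLp.inner_apply, Fin.sum_univ_three]

variable {X Y : TCP3 x}

theorem nkMetric_combination_kahlerJ (a b c d : ℝ) :
    nkMetric x (a • X + b • Y) (kahlerJ x (c • X + d • Y)) =
      (b * c - a * d) * nkMetric x Y (kahlerJ x X) := by
  simp only [kahlerJ_add, kahlerJ_smul, nkMetric_add_left, nkMetric_add_right, nkMetric_smul_left,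
    nkMetric_smul_right, nkMetric_kahlerJ_self, nkMetric_kahlerJ_antisymm X Y]
  ring

theorem kahlerJ_eq_smul (hX : nkMetric x X X = 1) (hY : nkMetric x Y Y = 1)
    (h : nkMetric x Y (kahlerJ x X) ^ 2 = 1) : kahlerJ x X = nkMetric x Y (kahlerJ x X) • Y := by
  by_contra hne
  have hpos := nkMetric_pos x (sub_ne_zero.2 hne)
  simp only [sub_eq_add_neg, ← neg_smul, nkMetric_add_left, nkMetric_add_right, nkMetric_smul_left,
    nkMetric_smul_right, nkMetric_kahlerJ_kahlerJ, hX, hY, nkMetric_comm (kahlerJ x X) Y] at hpos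
  nlinarith

theorem sq_nkMetric_kahlerJ_eq_one (hX : nkMetric x X X = 1) (hY : nkMetric x Y Y = 1)
    (hXY : nkMetric x X Y = 0) {a b : ℝ} (h : kahlerJ x X = a • X + b • Y) :
    nkMetric x Y (kahlerJ x X) ^ 2 = 1 := by
  have h1 := nkMetric_kahlerJ_kahlerJ X X
  have h2 := nkMetric_kahlerJ_self X
  rw [h] at h1 h2 ⊢
  simp only [nkMetric_add_right, nkMetric_smul_right, nkMetric_add_left, nkMetric_smul_left,
    hX, hY, hXY, nkMetric_comm Y X] at h1 h2 ⊢
  nlinarith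

/-- The vectors `X`, `Y` are an orthonormal basis for `g` of a plane totally real for `J`. -/
structure IsTotallyRealPair (X Y : TCP3 x) : Prop where
  fst_fst : nkMetric x X X = 1
  snd_snd : nkMetric x Y Y = 1
  fst_snd : nkMetric x X Y = 0
  fst_nkJ_snd : nkMetric x X (nkJ x Y) = 0

variable {φ : TCP3 x →ₗ[ℝ] EuclideanSpace ℂ (Fin 3)}

theorem IsTotallyRealPair.inner_map_map (h : IsTotallyRealPair X Y) (hφ : IsUnitaryCoord x φ) :
    inner ℂ (φ X) (φ Y) = 0 := by
  rw [hφ.inner_map_map, h.fst_snd, h.fst_nkJ_snd]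
  simp

theorem IsUnitaryCoord.norm_map (hφ : IsUnitaryCoord x φ) (hX : nkMetric x X X = 1) :
    ‖φ X‖ = 1 := by
  rw [← pow_eq_one_iff_of_nonneg (norm_nonneg _) two_ne_zero, ← inner_self_eq_norm_sq (𝕜 := ℂ)]
  exact (hφ.nkMetric_eq X X).symm.trans hX

theorem IsTotallyRealPair.orthonormal (h : IsTotallyRealPair X Y) (hφ : IsUnitaryCoord x φ) :
    Orthonormal ℂ ![φ X, φ Y] := by
  have hXY := h.inner_map_map hφ
  refine ⟨fun i => ?_, fun i j hij => ?_⟩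
  · fin_cases i <;> simp [hφ.norm_map h.fst_fst, hφ.norm_map h.snd_snd]
  · fin_cases i <;> fin_cases j <;> simp_all [inner_eq_zero_symm.1 hXY]

theorem IsTotallyRealPair.exists_orthonormalBasis (h : IsTotallyRealPair X Y)
    (hφ : IsUnitaryCoord x φ) : ∃ B : OrthonormalBasis (Fin 3) ℂ (EuclideanSpace ℂ (Fin 3)),
      ⇑B = ![φ X, φ Y, φ (nablaJ x X Y)] := by
  have ho := orthonormal_hermCross (h.orthonormal hφ)
  rw [← hφ.map_nablaJ] at ho
  exact ⟨OrthonormalBasis.mk ho (ho.linearIndependent.span_eq_top_of_card_eq_finrank (by simp)).ge,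
    OrthonormalBasis.coe_mk ho _⟩

theorem IsTotallyRealPair.norm_sq_apply_zero_add (h : IsTotallyRealPair X Y)
    (hφ : IsUnitaryCoord x φ) : ‖φ X 0‖ ^ 2 + ‖φ Y 0‖ ^ 2 + ‖φ (nablaJ x X Y) 0‖ ^ 2 = 1 := by
  obtain ⟨B, hB⟩ := h.exists_orthonormalBasis hφ
  have hsum := B.sum_sq_norm_inner_right (EuclideanSpace.single 0 (1 : ℂ))
  simpa [Fin.sum_univ_three, hB, EuclideanSpace.inner_single_right] using hsum

theorem IsUnitaryCoord.kahlerJ_eq_nkJ (hφ : IsUnitaryCoord x φ) (hX : φ X 0 = 0) :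
    kahlerJ x X = nkJ x X := by
  apply hφ.injective
  rw [hφ.map_nkJ, hφ.map_kahlerJ, hX]
  ext i
  fin_cases i <;> simp [hX]

theorem IsTotallyRealPair.map_kahlerJ_fst (h : IsTotallyRealPair X Y) (hφ : IsUnitaryCoord x φ)
    (hY : φ Y 0 = 0) :
    φ (kahlerJ x X) = (Complex.I * (1 - 2 * ‖φ X 0‖ ^ 2)) • φ X +
      (-2 * Complex.I * (conj (φ (nablaJ x X Y) 0) * φ X 0)) • φ (nablaJ x X Y) := by
  obtain ⟨B, hB⟩ := h.exists_orthonormalBasis hφ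
  have hUU : inner ℂ (φ X) (φ X) = (1 : ℂ) := by
    rw [inner_self_eq_norm_sq_to_K, hφ.norm_map h.fst_fst]
    simp
  have hVU : inner ℂ (φ Y) (φ X) = 0 := inner_eq_zero_symm.1 (h.inner_map_map hφ)
  have hGU : inner ℂ (φ (nablaJ x X Y)) (φ X) = 0 :=
    inner_eq_zero_symm.1 (hφ.map_nablaJ X Y ▸ inner_left_hermCross (φ X) (φ Y))
  have hsum := B.sum_repr' (φ (kahlerJ x X))
  simp only [Fin.sum_univ_three, hB, Matrix.cons_val, hφ.inner_map_kahlerJ, hUU, hVU, hGU, hY,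
    Complex.conj_mul', map_zero, zero_mul, mul_zero, sub_zero, zero_smul, add_zero] at hsum
  rw [← hsum]
  ring_nf

theorem IsTotallyRealPair.kahlerJ_fst_eq (h : IsTotallyRealPair X Y) (hφ : IsUnitaryCoord x φ)
    (hY : φ Y 0 = 0) {z : ℂ}
    (hz : z = -2 * Complex.I * (conj (φ (nablaJ x X Y) 0) * φ X 0)) :
    kahlerJ x X = (1 - 2 * ‖φ X 0‖ ^ 2) • nkJ x X + z.re • nablaJ x X Y
      + z.im • nkJ x (nablaJ x X Y) := by
  apply hφ.injective
  rw [h.map_kahlerJ_fst hφ hY, map_add, map_add, map_smul, map_smul, map_smul, hφ.map_nkJ,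
    hφ.map_nkJ, ← hz]
  nth_rewrite 1 [← Complex.re_add_im z]
  ext i
  simp only [PiLp.add_apply, PiLp.smul_apply, smul_eq_mul, Complex.real_smul]
  push_cast
  ring

end Linear

section HopfPushAt

variable {x : CP3} {v w w' : C4}

theorem nkMetric_hopfPushAt_kahlerJ (hv : ‖v‖ = 1) (hx : hopf v = x) (w w' : C4) :
    nkMetric x (hopfPushAt x v w) (kahlerJ x (hopfPushAt x v w')) =
      nkMetric x (hopfPushAt x v w) (nkJ x (hopfPushAt x v w')) +
        2 * (inner ℂ (quatJ v) w * conj (inner ℂ (quatJ v) w')).im := by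
  obtain ⟨φ, hφ, h0⟩ := exists_isUnitaryCoord_of_norm_eq_one hv hx
  rw [hφ.nkMetric_kahlerJ, h0, h0, Complex.conj_conj]

theorem apply_zero_nablaJ_hopfPushAt {φ : TCP3 x →ₗ[ℝ] EuclideanSpace ℂ (Fin 3)}
    (h0 : ∀ w, φ (hopfPushAt x v w) 0 = conj (inner ℂ (quatJ v) w)) (hv : ‖v‖ = 1)
    (hx : hopf v = x) (hw : inner ℂ v w = 0) (hw' : inner ℂ v w' = 0) :
    φ (nablaJ x (hopfPushAt x v w) (hopfPushAt x v w')) 0 =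
      2 * Complex.I * conj (inner ℂ (quatJ w) w') := by
  have hj : ∀ u, inner ℂ v u = 0 → inner ℂ (quatJ v) (quatJ u) = 0 := fun u hu => by
    rw [inner_quatJ_quatJ, inner_eq_zero_symm, hu]
  rw [nablaJ_hopfPushAt hv hx hw hw', h0, inner_sub_right, inner_add_right, inner_smul_right,
    inner_smul_right, inner_smul_right, hj w hw, hj w' hw', inner_self_eq_norm_sq_to_K,
    norm_quatJ, hv]
  simp [-inner_conj_symm, Complex.conj_ofNat]

theorem IsTotallyRealPair.norm_sq_inner_quatJ_add
    (h : IsTotallyRealPair (hopfPushAt x v w) (hopfPushAt x v w')) (hv : ‖v‖ = 1)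
    (hx : hopf v = x) (hw : inner ℂ v w = 0) (hw' : inner ℂ v w' = 0) :
    ‖inner ℂ (quatJ v) w‖ ^ 2 + ‖inner ℂ (quatJ v) w'‖ ^ 2 +
      4 * ‖inner ℂ (quatJ w) w'‖ ^ 2 = 1 := by
  obtain ⟨φ, hφ, h0⟩ := exists_isUnitaryCoord_of_norm_eq_one hv hx
  have hsum := h.norm_sq_apply_zero_add hφ
  rw [apply_zero_nablaJ_hopfPushAt h0 hv hx hw hw', h0, h0, RCLike.norm_conj, RCLike.norm_conj,
    norm_mul, norm_mul, RCLike.norm_conj, Complex.norm_I, Complex.norm_ofNat] at hsum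
  linarith

theorem kahlerJ_hopfPushAt_eq_nkJ (hv : ‖v‖ = 1) (hx : hopf v = x)
    (hw : inner ℂ (quatJ v) w = 0) :
    kahlerJ x (hopfPushAt x v w) = nkJ x (hopfPushAt x v w) := by
  obtain ⟨φ, hφ, h0⟩ := exists_isUnitaryCoord_of_norm_eq_one hv hx
  exact hφ.kahlerJ_eq_nkJ (by rw [h0, hw, map_zero])

theorem IsTotallyRealPair.kahlerJ_hopfPushAt_eq
    (h : IsTotallyRealPair (hopfPushAt x v w) (hopfPushAt x v w')) (hv : ‖v‖ = 1)
    (hx : hopf v = x) (hw : inner ℂ v w = 0) (hw' : inner ℂ v w' = 0)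
    (hjw' : inner ℂ (quatJ v) w' = 0) {z : ℂ}
    (hz : z = -4 * (conj (inner ℂ (quatJ v) w) * inner ℂ (quatJ w) w')) :
    kahlerJ x (hopfPushAt x v w) =
      (1 - 2 * ‖inner ℂ (quatJ v) w‖ ^ 2) • nkJ x (hopfPushAt x v w)
        + z.re • nablaJ x (hopfPushAt x v w) (hopfPushAt x v w')
        + z.im • nkJ x (nablaJ x (hopfPushAt x v w) (hopfPushAt x v w')) := by
  obtain ⟨φ, hφ, h0⟩ := exists_isUnitaryCoord_of_norm_eq_one hv hx
  have hX := h.kahlerJ_fst_eq (z := z) hφ (by rw [h0, hjw', map_zero]) (by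
    rw [hz, apply_zero_nablaJ_hopfPushAt h0 hv hx hw hw', h0]
    simp only [map_mul, Complex.conj_ofNat, Complex.conj_I, RingHomCompTriple.comp_apply]
    linear_combination (-4 * conj (inner ℂ (quatJ v) w) * inner ℂ (quatJ w) w') * Complex.I_mul_I)
  rwa [h0, RCLike.norm_conj] at hX

end HopfPushAt

/-! ### Lifts of surfaces to `S⁷` -/

theorem inner_quatJ_fderiv_eq_zero {E : Type*} [NormedAddCommGroup E] [NormedSpace ℝ E]
    {F : E → C4} {Ω : Set E} (hΩ : IsOpen Ω) (hF : ContDiffOn ℝ ∞ F Ω) {a b : E}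
    (ha : ∀ y ∈ Ω, inner ℂ (quatJ (F y)) (fderiv ℝ F y a) = 0)
    (hb : ∀ y ∈ Ω, inner ℂ (quatJ (F y)) (fderiv ℝ F y b) = 0) {y : E} (hy : y ∈ Ω) :
    inner ℂ (quatJ (fderiv ℝ F y a)) (fderiv ℝ F y b) = 0 := by
  have hFy : ContDiffAt ℝ ∞ F y := hF.contDiffAt (hΩ.mem_nhds hy)
  have hF1 : HasFDerivAt F (fderiv ℝ F y) y := (hFy.differentiableAt (by simp)).hasFDerivAt
  have hF2 : HasFDerivAt (fderiv ℝ F) (fderiv ℝ (fderiv ℝ F) y) y :=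
    ((hFy.fderiv_right (m := 1) (by norm_cast)).differentiableAt (by simp)).hasFDerivAt
  have hsymm := hFy.isSymmSndFDerivAt (by simpa using ENat.LEInfty.out)
  have deriv_contact : ∀ c d : E, (∀ y ∈ Ω, inner ℂ (quatJ (F y)) (fderiv ℝ F y c) = 0) →
      inner ℂ (quatJ (F y)) (fderiv ℝ (fderiv ℝ F) y d c)
        + inner ℂ (quatJ (fderiv ℝ F y d)) (fderiv ℝ F y c) = 0 := by
    intro c d hc
    have h1 : HasFDerivAt (fun y => quatJ (F y))
        ((LinearMap.toContinuousLinearMap quatJ).comp (fderiv ℝ F y)) y :=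
      (LinearMap.toContinuousLinearMap quatJ).hasFDerivAt.comp y hF1
    have h2 : HasFDerivAt (fun y => fderiv ℝ F y c)
        ((fderiv ℝ (fderiv ℝ F) y).flip c) y := by
      simpa using hF2.clm_apply (hasFDerivAt_const c y)
    have hzero : HasFDerivAt (fun y => inner ℂ (quatJ (F y)) (fderiv ℝ F y c))
        (0 : E →L[ℝ] ℂ) y := by
      refine (hasFDerivAt_const (0 : ℂ) y).congr_of_eventuallyEq ?_
      filter_upwards [hΩ.mem_nhds hy] with z hz using hc z hz
    simpa [fderivInnerCLM_apply] using
      congrArg (fun L : E →L[ℝ] ℂ => L d) ((h1.inner ℂ h2).unique hzero)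
  have hab := deriv_contact a b ha
  have hba := deriv_contact b a hb
  rw [hsymm b a, inner_quatJ_antisymm (fderiv ℝ F y b)] at hab
  exact self_eq_neg.1 (by linear_combination hba - hab)

section Smoothness

variable {E H M F G : Type*} [NormedAddCommGroup E] [NormedSpace ℝ E] [TopologicalSpace H]
  {I : ModelWithCorners ℝ E H} [TopologicalSpace M] [ChartedSpace H M]
  [NormedAddCommGroup F] [NormedSpace ℝ F] [NormedAddCommGroup G] [NormedSpace ℝ G] {O : Set M}

theorem contMDiffOn_comp_of_contDiffAt {g : F → G} {h : M → F}
    (hg : ∀ p ∈ O, ContDiffAt ℝ ∞ g (h p)) (hh : ContMDiffOn I 𝓘(ℝ, F) ∞ h O) :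
    ContMDiffOn I 𝓘(ℝ, G) ∞ (fun p => g (h p)) O :=
  fun p hp => (hg p hp).comp_contMDiffWithinAt (hh p hp)

theorem contMDiffOn_comp_of_contDiff {g : F → G} {h : M → F} (hg : ContDiff ℝ ∞ g)
    (hh : ContMDiffOn I 𝓘(ℝ, F) ∞ h O) : ContMDiffOn I 𝓘(ℝ, G) ∞ (fun p => g (h p)) O :=
  contMDiffOn_comp_of_contDiffAt (fun _ _ => hg.contDiffAt) hh

theorem contMDiffOn_inner {w w' : M → C4} (hw : ContMDiffOn I 𝓘(ℝ, C4) ∞ w O)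
    (hw' : ContMDiffOn I 𝓘(ℝ, C4) ∞ w' O) :
    ContMDiffOn I 𝓘(ℝ, ℂ) ∞ (fun p => (inner ℂ (w p) (w' p) : ℂ)) O :=
  contMDiffOn_comp_of_contDiff (g := fun z : C4 × C4 => (inner ℂ z.1 z.2 : ℂ))
    contDiff_inner (hw.prodMk_space hw')

theorem contMDiffOn_quatJ {w : M → C4} (hw : ContMDiffOn I 𝓘(ℝ, C4) ∞ w O) :
    ContMDiffOn I 𝓘(ℝ, C4) ∞ (fun p => quatJ (w p)) O :=
  contMDiffOn_comp_of_contDiff (LinearMap.toContinuousLinearMap quatJ).contDiff hw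

theorem contMDiffOn_inv_sqrt {h : M → ℝ} (hh : ContMDiffOn I 𝓘(ℝ, ℝ) ∞ h O)
    (h0 : ∀ p ∈ O, 0 < h p) : ContMDiffOn I 𝓘(ℝ, ℝ) ∞ (fun p => (√(h p))⁻¹) O :=
  contMDiffOn_comp_of_contDiffAt (g := fun t : ℝ => (√t)⁻¹)
    (fun p hp => (Real.contDiffAt_sqrt (h0 p hp).ne').inv (Real.sqrt_ne_zero'.2 (h0 p hp))) hh

theorem contMDiffOn_mvfderiv_apply [IsManifold I ∞ M] (hO : IsOpen O) {h : M → F}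
    (hh : ContMDiffOn I 𝓘(ℝ, F) ∞ h O) {X : ∀ p : M, TangentSpace I p}
    (hX : ContMDiffOn I I.tangent ∞ (fun p => (⟨p, X p⟩ : TangentBundle I M)) O) :
    ContMDiffOn I 𝓘(ℝ, F) ∞ (fun p => mvfderiv I h p (X p)) O := by
  have htangent := (hh.contMDiffOn_tangentMapWithin (m := ∞) (by simp) hO.uniqueMDiffOn).comp hX
    fun p hp => hp
  refine ((contMDiff_snd_tangentBundle_modelSpace F 𝓘(ℝ, F)).comp_contMDiffOn htangent).congr
    fun p hp => ?_
  change mvfderiv I h p (X p) = mfderivWithin I 𝓘(ℝ, F) h O p (X p)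
  rw [mfderivWithin_of_isOpen hO hp]
  rfl

theorem mvfderiv_eq_fderiv_extChartAt {h : M → F} {p : M}
    (hh : DifferentiableAt ℝ (h ∘ (extChartAt I p).symm) (extChartAt I p p))
    (Z : TangentSpace I p) :
    mvfderiv I h p Z = fderiv ℝ (h ∘ (extChartAt I p).symm) (extChartAt I p p)
      (mvfderiv I (extChartAt I p) p Z) := by
  have hchart : h =ᶠ[nhds p] (h ∘ (extChartAt I p).symm) ∘ extChartAt I p := by
    filter_upwards [extChartAt_source_mem_nhds (I := I) p] with q hq
    exact congrArg h ((extChartAt I p).left_inv hq).symm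
  exact ((congrArg (fun L : TangentSpace I p →L[ℝ] F => L Z) hchart.mfderiv_eq).trans
    (mfderiv_comp_apply p hh.mdifferentiableAt
      ((contMDiffAt_extChartAt (n := 1)).mdifferentiableAt (by simp)) Z)).trans
        (DFunLike.congr_fun mfderiv_eq_fderiv _)

end Smoothness

section Lifts

variable {M : Type*} [TopologicalSpace M] [ChartedSpace (EuclideanSpace ℝ (Fin 2)) M]
  {f : M → CP3} {O O' : Set M} {v : M → C4} {p : M} {X Y : ∀ p : M, TangentSpace (𝓡 2) p}

/-- The map `v` is a smooth lift of `f` to the unit sphere of `ℂ⁴` on the set `O`. -/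
structure IsLiftOn (f : M → CP3) (O : Set M) (v : M → C4) : Prop where
  smooth : ContMDiffOn (𝓡 2) 𝓘(ℝ, C4) ∞ v O
  norm_eq : ∀ p ∈ O, ‖v p‖ = 1
  hopf_eq : ∀ p ∈ O, hopf (v p) = f p

/-- The component of `dv X` orthogonal to the Hopf fibre; if `v` lifts `f` to the unit sphere,
this is the horizontal lift of `df X`. -/
noncomputable def horizontalLift (v : M → C4) (p : M) : TangentSpace (𝓡 2) p →ₗ[ℝ] C4 :=
  (LinearMap.id - (innerSL ℂ (v p)).toLinearMap.smulRight (v p)).restrictScalars ℝ ∘ₗ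
    (mvfderiv (𝓡 2) v p).toLinearMap

/-- The pull-back along `v` of the complex contact form `⟨j·, d·⟩` of the sphere `S⁷`, whose
kernel is the horizontal distribution of the twistor fibration. -/
noncomputable def contactForm (v : M → C4) (p : M) : TangentSpace (𝓡 2) p →ₗ[ℝ] ℂ :=
  (innerSL ℂ (quatJ (v p))).toLinearMap.restrictScalars ℝ ∘ₗ horizontalLift v p

theorem horizontalLift_apply (Z : TangentSpace (𝓡 2) p) :
    horizontalLift v p Z =
      mvfderiv (𝓡 2) v p Z - (inner ℂ (v p) (mvfderiv (𝓡 2) v p Z) : ℂ) • v p :=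
  rfl

theorem contactForm_apply (Z : TangentSpace (𝓡 2) p) :
    contactForm v p Z = inner ℂ (quatJ (v p)) (horizontalLift v p Z) :=
  rfl

theorem contactForm_eq_inner_mvfderiv (Z : TangentSpace (𝓡 2) p) :
    contactForm v p Z = inner ℂ (quatJ (v p)) (mvfderiv (𝓡 2) v p Z) := by
  rw [contactForm_apply, horizontalLift_apply, inner_sub_right, inner_smul_right,
    self_eq_neg.1 (inner_quatJ_antisymm (v p) (v p)), mul_zero, sub_zero]

namespace IsLiftOn

theorem mono (hv : IsLiftOn f O v) (hO : O' ⊆ O) : IsLiftOn f O' v :=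
  ⟨hv.smooth.mono hO, fun p hp => hv.norm_eq p (hO hp), fun p hp => hv.hopf_eq p (hO hp)⟩

theorem ne_zero (hv : IsLiftOn f O v) (hp : p ∈ O) : v p ≠ 0 :=
  norm_ne_zero_iff.1 (by simp [hv.norm_eq p hp])

theorem inner_horizontalLift (hv : IsLiftOn f O v) (hp : p ∈ O) (Z : TangentSpace (𝓡 2) p) :
    inner ℂ (v p) (horizontalLift v p Z) = 0 := by
  rw [horizontalLift_apply, inner_sub_right, inner_smul_right, inner_self_eq_norm_sq_to_K,
    hv.norm_eq p hp]
  simp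

theorem mdifferentiableAt (hv : IsLiftOn f O v) (hO : IsOpen O) (hp : p ∈ O) :
    MDifferentiableAt (𝓡 2) 𝓘(ℝ, C4) v p :=
  ((hv.smooth p hp).contMDiffAt (hO.mem_nhds hp)).mdifferentiableAt (by simp)

theorem surfD_eq (hv : IsLiftOn f O v) (hO : IsOpen O) (hp : p ∈ O) (Z : TangentSpace (𝓡 2) p) :
    surfD f p Z = hopfPushAt (f p) (v p) (horizontalLift v p Z) := by
  have hfv : f =ᶠ[nhds p] hopf ∘ v := by
    filter_upwards [hO.mem_nhds hp] with q hq using (hv.hopf_eq q hq).symm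
  have hchain : surfD f p Z = (hopfPushAt (hopf (v p)) (v p) (mvfderiv (𝓡 2) v p Z) : C3) :=
    ((congrArg (fun L : TangentSpace (𝓡 2) p →L[ℝ] C3 => L Z) hfv.mfderiv_eq).trans
      (mfderiv_comp_apply p (hasMFDerivAt_hopf (hv.ne_zero hp)).mdifferentiableAt
        (hv.mdifferentiableAt hO hp) Z)).trans (mfderiv_hopf_eq_hopfPushAt (hv.ne_zero hp) _)
  have hopfPushAt_congr : ∀ x, hopf (v p) = x → ∀ w : C4,
      (hopfPushAt (hopf (v p)) (v p) w : C3) = hopfPushAt x (v p) w := by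
    rintro _ rfl _
    rfl
  rw [horizontalLift_apply, map_sub, hopfPushAt_smul_self (hv.ne_zero hp) (hv.hopf_eq p hp),
    sub_zero]
  exact hchain.trans (hopfPushAt_congr _ (hv.hopf_eq p hp) _)

theorem contMDiffOn_horizontalLift [IsManifold (𝓡 2) ∞ M] (hv : IsLiftOn f O v) (hO : IsOpen O)
    (hX : ContMDiffOn (𝓡 2) (𝓡 2).tangent ∞
      (fun p => (⟨p, X p⟩ : TangentBundle (𝓡 2) M)) O) :
    ContMDiffOn (𝓡 2) 𝓘(ℝ, C4) ∞ (fun p => horizontalLift v p (X p)) O := by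
  have hdv := contMDiffOn_mvfderiv_apply hO hv.smooth hX
  exact hdv.sub (contMDiffOn_comp_of_contDiff (g := fun z : ℂ × C4 => z.1 • z.2)
    (contDiff_fst.smul contDiff_snd) ((contMDiffOn_inner hv.smooth hdv).prodMk_space hv.smooth))

theorem contMDiffOn_contactForm [IsManifold (𝓡 2) ∞ M] (hv : IsLiftOn f O v) (hO : IsOpen O)
    (hX : ContMDiffOn (𝓡 2) (𝓡 2).tangent ∞
      (fun p => (⟨p, X p⟩ : TangentBundle (𝓡 2) M)) O) :
    ContMDiffOn (𝓡 2) 𝓘(ℝ, ℂ) ∞ (fun p => contactForm v p (X p)) O :=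
  contMDiffOn_inner (contMDiffOn_quatJ hv.smooth) (hv.contMDiffOn_horizontalLift hO hX)

theorem contMDiffOn_nkMetric_surfD [IsManifold (𝓡 2) ∞ M] (hv : IsLiftOn f O v) (hO : IsOpen O)
    (hX : ContMDiffOn (𝓡 2) (𝓡 2).tangent ∞
      (fun p => (⟨p, X p⟩ : TangentBundle (𝓡 2) M)) O)
    (hY : ContMDiffOn (𝓡 2) (𝓡 2).tangent ∞
      (fun p => (⟨p, Y p⟩ : TangentBundle (𝓡 2) M)) O) :
    ContMDiffOn (𝓡 2) 𝓘(ℝ, ℝ) ∞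
      (fun p => nkMetric (f p) (surfD f p (X p)) (surfD f p (Y p))) O := by
  have hmetric : ContDiff ℝ ∞ fun z : (ℂ × ℂ) × ℂ => 2 * z.1.1.re - (conj z.1.2 * z.2).re := by
    simp only [← Complex.reCLM_apply, ← Complex.conjCLE_apply]
    fun_prop
  refine (contMDiffOn_comp_of_contDiff hmetric (((contMDiffOn_inner
    (hv.contMDiffOn_horizontalLift hO hX) (hv.contMDiffOn_horizontalLift hO hY)).prodMk_space
      (hv.contMDiffOn_contactForm hO hX)).prodMk_space
        (hv.contMDiffOn_contactForm hO hY))).congr fun p hp => ?_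
  rw [hv.surfD_eq hO hp, hv.surfD_eq hO hp, nkMetric_hopfPushAt (hv.norm_eq p hp) (hv.hopf_eq p hp),
    hv.inner_horizontalLift hp, mul_zero, sub_zero, contactForm_apply, contactForm_apply,
    inner_conj_symm]

theorem inner_quatJ_mvfderiv_eq_zero [IsManifold (𝓡 2) ∞ M] (hv : IsLiftOn f O v) (hO : IsOpen O)
    (h : ∀ p ∈ O, contactForm v p = 0) (hp : p ∈ O) (Z Z' : TangentSpace (𝓡 2) p) :
    inner ℂ (quatJ (mvfderiv (𝓡 2) v p Z)) (mvfderiv (𝓡 2) v p Z') = 0 := by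
  let φ := extChartAt (𝓡 2) p
  let F := v ∘ φ.symm
  let Ω := φ.target ∩ φ.symm ⁻¹' O
  have hφ : ContMDiffOn 𝓘(ℝ, EuclideanSpace ℝ (Fin 2)) (𝓡 2) ∞ φ.symm φ.target :=
    contMDiffOn_extChartAt_symm p
  have hΩ : IsOpen Ω :=
    hφ.continuousOn.isOpen_inter_preimage (isOpen_extChartAt_target p) hO
  have hF : ContDiffOn ℝ ∞ F Ω :=
    contMDiffOn_iff_contDiffOn.1 (hv.smooth.comp (hφ.mono Set.inter_subset_left) fun y hy => hy.2)
  have hFcontact : ∀ a, ∀ y ∈ Ω, inner ℂ (quatJ (F y)) (fderiv ℝ F y a) = 0 := by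
    intro a y hy
    have hφy := ((hφ y hy.1).contMDiffAt
      ((isOpen_extChartAt_target p).mem_nhds hy.1)).mdifferentiableAt (by simp)
    obtain ⟨Z, hZ⟩ : ∃ Z : TangentSpace (𝓡 2) (φ.symm y),
        fderiv ℝ F y a = mvfderiv (𝓡 2) v (φ.symm y) Z :=
      ⟨_, (DFunLike.congr_fun mfderiv_eq_fderiv a).symm.trans
        (mfderiv_comp_apply y (hv.mdifferentiableAt hO hy.2) hφy a)⟩
    change inner ℂ (quatJ (v (φ.symm y))) _ = 0
    rw [hZ, ← contactForm_eq_inner_mvfderiv, h _ hy.2, LinearMap.zero_apply]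
  have hpφ : φ.symm (φ p) = p := φ.left_inv (mem_extChartAt_source p)
  have hpΩ : φ p ∈ Ω := ⟨mem_extChartAt_target p, by rwa [Set.mem_preimage, hpφ]⟩
  have hFp := (hF.contDiffAt (hΩ.mem_nhds hpΩ)).differentiableAt (by simp)
  rw [mvfderiv_eq_fderiv_extChartAt hFp, mvfderiv_eq_fderiv_extChartAt hFp]
  exact inner_quatJ_fderiv_eq_zero hΩ hF (hFcontact _) (hFcontact _) hpΩ

theorem inner_quatJ_horizontalLift_eq_zero [IsManifold (𝓡 2) ∞ M] (hv : IsLiftOn f O v)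
    (hO : IsOpen O) (h : ∀ p ∈ O, contactForm v p = 0) (hp : p ∈ O)
    (Z Z' : TangentSpace (𝓡 2) p) :
    inner ℂ (quatJ (horizontalLift v p Z)) (horizontalLift v p Z') = 0 := by
  have hcontact : ∀ Z, inner ℂ (quatJ (v p)) (mvfderiv (𝓡 2) v p Z) = 0 := fun Z => by
    rw [← contactForm_eq_inner_mvfderiv, h p hp, LinearMap.zero_apply]
  have hcontact' : ∀ Z, inner ℂ (quatJ (mvfderiv (𝓡 2) v p Z)) (v p) = 0 := fun Z => by
    rw [inner_quatJ_antisymm, hcontact, neg_zero]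
  rw [horizontalLift_apply, horizontalLift_apply, map_sub, quatJ_smul]
  simp only [inner_sub_left, inner_sub_right, inner_smul_left, inner_smul_right, hcontact,
    hcontact', self_eq_neg.1 (inner_quatJ_antisymm (v p) (v p)),
    hv.inner_quatJ_mvfderiv_eq_zero hO h hp, mul_zero, sub_zero]

end IsLiftOn

end Lifts

/-! ### Orthonormal frames -/

section Frames

variable {M : Type*} [TopologicalSpace M] [ChartedSpace (EuclideanSpace ℝ (Fin 2)) M]
  {f : M → CP3} {O O' : Set M} {v : M → C4}

theorem exists_isLiftOn (hf : ContMDiff (𝓡 2) 𝓘(ℝ, C3) ∞ f) (p₀ : M) :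
    ∃ O, IsOpen O ∧ p₀ ∈ O ∧ ∃ v, IsLiftOn f O v := by
  let b := adaptedBasis (f p₀)
  let c := chartAt C3 (f p₀)
  let A : M → C4 := fun p => affineVec b (c (f p))
  have hA0 : ∀ p, A p ≠ 0 := fun p => affineVec_ne_zero b _
  have hA : ContMDiffOn (𝓡 2) 𝓘(ℝ, C4) ∞ A (f ⁻¹' c.source) :=
    contMDiffOn_comp_of_contDiff (contDiff_affineVec b)
      ((contMDiffOn_chart (I := 𝓘(ℝ, C3)) (n := ∞) (x := f p₀)).comp hf.contMDiffOn
        fun _ hp => hp)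
  have hinv : ContMDiffOn (𝓡 2) 𝓘(ℝ, ℝ) ∞ (fun p => ‖A p‖⁻¹) (f ⁻¹' c.source) :=
    contMDiffOn_comp_of_contDiffAt (g := fun w : C4 => ‖w‖⁻¹)
      (fun p _ => (contDiffAt_norm ℝ (hA0 p)).inv (norm_ne_zero_iff.2 (hA0 p))) hA
  refine ⟨f ⁻¹' c.source, c.open_source.preimage hf.continuous, mem_chart_source C3 (f p₀),
    fun p => ‖A p‖⁻¹ • A p, hinv.smul hA, fun p _ => ?_, fun p hp => ?_⟩
  · rw [norm_smul, norm_inv, norm_norm, inv_mul_cancel₀ (norm_ne_zero_iff.2 (hA0 p))]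
  · rw [← Complex.coe_smul,
      hopf_smul (Complex.ofReal_ne_zero.2 (inv_ne_zero (norm_ne_zero_iff.2 (hA0 p)))) (hA0 p)]
    exact c.left_inv hp

variable [IsManifold (𝓡 2) ∞ M] {U V X Y : ∀ p : M, TangentSpace (𝓡 2) p} {p : M}

theorem IsLiftOn.exists_eq_smul_unit (hv : IsLiftOn f O v) (hO : IsOpen O)
    (hf : IsImmersedSurface f)
    (hX : ContMDiffOn (𝓡 2) (𝓡 2).tangent ∞ (fun p => (⟨p, X p⟩ : TangentBundle (𝓡 2) M)) O)
    (hX0 : ∀ p ∈ O, X p ≠ 0) :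
    ∃ (r : M → ℝ) (U : ∀ p : M, TangentSpace (𝓡 2) p),
      ContMDiffOn (𝓡 2) (𝓡 2).tangent ∞ (fun p => (⟨p, U p⟩ : TangentBundle (𝓡 2) M)) O ∧
      (∀ p, U p = r p • X p) ∧
      ∀ p ∈ O, nkMetric (f p) (surfD f p (U p)) (surfD f p (U p)) = 1 := by
  have hpos : ∀ p ∈ O, 0 < nkMetric (f p) (surfD f p (X p)) (surfD f p (X p)) := fun p hp =>
    nkMetric_pos _ ((map_ne_zero_iff _ (hf.injective p)).2 (hX0 p hp))
  refine ⟨fun p => (√(nkMetric (f p) (surfD f p (X p)) (surfD f p (X p))))⁻¹,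
    fun p => (√(nkMetric (f p) (surfD f p (X p)) (surfD f p (X p))))⁻¹ • X p,
    (contMDiffOn_inv_sqrt (hv.contMDiffOn_nkMetric_surfD hO hX hX) hpos).smul_section hX,
    fun _ => rfl, fun p hp => ?_⟩
  rw [map_smul, nkMetric_smul_left, nkMetric_smul_right, ← mul_assoc, ← mul_inv,
    Real.mul_self_sqrt (hpos p hp).le, inv_mul_cancel₀ (hpos p hp).ne']

theorem IsLiftOn.exists_isOrthonormalFrameOn (hv : IsLiftOn f O v) (hO : IsOpen O)
    (hf : IsImmersedSurface f)
    (hX : ContMDiffOn (𝓡 2) (𝓡 2).tangent ∞ (fun p => (⟨p, X p⟩ : TangentBundle (𝓡 2) M)) O)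
    (hY : ContMDiffOn (𝓡 2) (𝓡 2).tangent ∞ (fun p => (⟨p, Y p⟩ : TangentBundle (𝓡 2) M)) O)
    (hXY : ∀ p ∈ O, LinearIndependent ℝ ![X p, Y p]) :
    ∃ U V, IsOrthonormalFrameOn f O U V := by
  simp only [LinearIndependent.pair_iff] at hXY
  obtain ⟨r, U, hU, hUX, hU1⟩ := hv.exists_eq_smul_unit hO hf hX fun p hp h =>
    one_ne_zero (hXY p hp 1 0 (by rw [h, smul_zero, zero_smul, add_zero])).1
  let c := fun p => nkMetric (f p) (surfD f p (U p)) (surfD f p (Y p))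
  obtain ⟨t, V, hV, hVZ, hV1⟩ := hv.exists_eq_smul_unit (X := fun p => (-c p) • U p + Y p) hO hf
    (((hv.contMDiffOn_nkMetric_surfD hO hU hY).neg.smul_section hU).add_section hY)
    fun p hp h => one_ne_zero (hXY p hp (-c p * r p) 1
      (by rw [← h, hUX, mul_smul, one_smul])).2
  refine ⟨U, V, hU, hV, hU1, hV1, fun p hp => ?_⟩
  rw [hVZ, map_smul, map_add, map_smul, nkMetric_smul_right, nkMetric_add_right,
    nkMetric_smul_right, hU1 p hp, mul_one, neg_add_cancel, mul_zero]

theorem exists_isLiftOn_isOrthonormalFrameOn (hf : IsImmersedSurface f) (p₀ : M) :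
    ∃ O, IsOpen O ∧ p₀ ∈ O ∧ ∃ v U V, IsLiftOn f O v ∧ IsOrthonormalFrameOn f O U V := by
  obtain ⟨O, hO, hp₀, v, hv⟩ := exists_isLiftOn hf.smooth p₀
  let e := trivializationAt (EuclideanSpace ℝ (Fin 2)) (TangentSpace (𝓡 2) : M → Type _) p₀
  have hs := (e.isLocalFrameOn_localFrame_baseSet (𝓡 2) ∞
    (EuclideanSpace.basisFun (Fin 2) ℝ).toBasis).mono (Set.inter_subset_right (s := O))
  have hv' := hv.mono (Set.inter_subset_left (t := e.baseSet))
  have hO' := hO.inter e.open_baseSet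
  obtain ⟨U, V, h⟩ := hv'.exists_isOrthonormalFrameOn hO' hf (hs.contMDiffOn 0)
    (hs.contMDiffOn 1) fun p hp => by
      refine LinearIndependent.pair_iff.2 fun a b hab => Fin.forall_fin_two.1
        (Fintype.linearIndependent_iff.1 (hs.linearIndependent hp) ![a, b] ?_)
      rwa [Fin.sum_univ_two]
  exact ⟨_, hO', ⟨hp₀, FiberBundle.mem_baseSet_trivializationAt' p₀⟩, v, U, V, hv', h⟩

namespace IsOrthonormalFrameOn

theorem mono (h : IsOrthonormalFrameOn f O U V) (hO : O' ⊆ O) : IsOrthonormalFrameOn f O' U V :=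
  ⟨h.smooth_fst.mono hO, h.smooth_snd.mono hO, fun p hp => h.fst_fst p (hO hp),
    fun p hp => h.snd_snd p (hO hp), fun p hp => h.fst_snd p (hO hp)⟩

theorem swap (h : IsOrthonormalFrameOn f O U V) : IsOrthonormalFrameOn f O V U :=
  ⟨h.smooth_snd, h.smooth_fst, h.snd_snd, h.fst_fst, fun p hp => by
    rw [nkMetric_comm, h.fst_snd p hp]⟩

theorem rotate (h : IsOrthonormalFrameOn f O U V) {a b : M → ℝ}
    (ha : ContMDiffOn (𝓡 2) 𝓘(ℝ, ℝ) ∞ a O) (hb : ContMDiffOn (𝓡 2) 𝓘(ℝ, ℝ) ∞ b O)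
    (hab : ∀ p ∈ O, a p ^ 2 + b p ^ 2 = 1) :
    IsOrthonormalFrameOn f O (fun p => a p • U p + b p • V p)
      (fun p => (-b p) • U p + a p • V p) := by
  refine ⟨(ha.smul_section h.smooth_fst).add_section (hb.smul_section h.smooth_snd),
    (hb.neg.smul_section h.smooth_fst).add_section (ha.smul_section h.smooth_snd),
    fun p hp => ?_, fun p hp => ?_, fun p hp => ?_⟩ <;>
  · simp only [map_add, map_smul, nkMetric_add_left, nkMetric_add_right, nkMetric_smul_left,
      nkMetric_smul_right, h.fst_fst p hp, h.snd_snd p hp, h.fst_snd p hp,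
      nkMetric_comm (surfD f p (V p)) (surfD f p (U p))]
    linarith [hab p hp]

theorem isTotallyRealPair (h : IsOrthonormalFrameOn f O U V) (hTR : IsNKTotallyReal f)
    (hp : p ∈ O) : IsTotallyRealPair (surfD f p (U p)) (surfD f p (V p)) :=
  ⟨h.fst_fst p hp, h.snd_snd p hp, h.fst_snd p hp, hTR p _ _⟩

theorem linearIndependent (h : IsOrthonormalFrameOn f O U V) (hp : p ∈ O) :
    LinearIndependent ℝ ![U p, V p] := by
  refine LinearIndependent.pair_iff.2 fun a b hab => ?_
  have hcoeff : ∀ Z, a * nkMetric (f p) (surfD f p (U p)) Z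
      + b * nkMetric (f p) (surfD f p (V p)) Z = 0 := fun Z => by
    rw [← nkMetric_smul_left, ← nkMetric_smul_left, ← nkMetric_add_left, ← map_smul, ← map_smul,
      ← map_add, hab, map_zero, ← zero_smul ℝ (0 : TCP3 (f p)), nkMetric_smul_left, zero_mul]
  have ha := hcoeff (surfD f p (U p))
  have hb := hcoeff (surfD f p (V p))
  rw [nkMetric_comm (surfD f p (V p)), h.fst_fst p hp, h.fst_snd p hp] at ha
  rw [h.fst_snd p hp, h.snd_snd p hp] at hb
  constructor <;> linarith

theorem exists_eq_combination (h : IsOrthonormalFrameOn f O U V) (hp : p ∈ O)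
    (X : TangentSpace (𝓡 2) p) : ∃ a b : ℝ, X = a • U p + b • V p := by
  have hfin : Fintype.card (Fin 2) = Module.finrank ℝ (TangentSpace (𝓡 2) p) :=
    (finrank_euclideanSpace (𝕜 := ℝ)).symm
  have hX : X ∈ Submodule.span ℝ (Set.range ![U p, V p]) :=
    (h.linearIndependent hp).span_eq_top_of_card_eq_finrank hfin ▸ Submodule.mem_top
  rw [Matrix.range_cons_cons_empty, Submodule.mem_span_pair] at hX
  obtain ⟨a, b, hab⟩ := hX
  exact ⟨a, b, hab.symm⟩

end IsOrthonormalFrameOn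

end Frames

/-! ### Local normal forms of `J∘` -/

section Argument

variable {E H M : Type*} [NormedAddCommGroup E] [NormedSpace ℝ E] [TopologicalSpace H]
  {I : ModelWithCorners ℝ E H} [TopologicalSpace M] [ChartedSpace H M] {O : Set M} {ζ η : M → ℂ}

theorem exists_contMDiffOn_eq_norm_mul_exp (hO : IsOpen O) (hζ : ContMDiffOn I 𝓘(ℝ, ℂ) ∞ ζ O)
    {p₀ : M} (hp₀ : p₀ ∈ O) (h0 : ζ p₀ ≠ 0) :
    ∃ O' ⊆ O, IsOpen O' ∧ p₀ ∈ O' ∧ ∃ ψ : M → ℝ, ContMDiffOn I 𝓘(ℝ, ℝ) ∞ ψ O' ∧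
      ∀ p ∈ O', ζ p = ‖ζ p‖ * Complex.exp (ψ p * Complex.I) := by
  have hopen := (hζ.continuousOn.div_const (ζ p₀)).isOpen_inter_preimage hO
    Complex.isOpen_slitPlane
  refine ⟨_, Set.inter_subset_left, hopen, ⟨hp₀, ?_⟩,
    fun p => (ζ p₀).arg + (Complex.log (ζ p / ζ p₀)).im,
    contMDiffOn_comp_of_contDiffAt (g := fun z => (ζ p₀).arg + (Complex.log (z / ζ p₀)).im)
      (fun p hp => ?_) (hζ.mono Set.inter_subset_left), fun p _ => ?_⟩
  · rw [Set.mem_preimage, div_self h0]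
    exact Complex.one_mem_slitPlane
  · have hlog : ContDiffAt ℂ ∞ (fun z => Complex.log (z / ζ p₀)) (ζ p) :=
      (Complex.contDiffAt_log hp.2).comp (ζ p) (contDiffAt_id.div_const _)
    exact contDiffAt_const.add
      (Complex.imCLM.contDiff.contDiffAt.comp (ζ p) (hlog.restrict_scalars ℝ))
  · calc ζ p = ζ p₀ * (ζ p / ζ p₀) := (mul_div_cancel₀ _ h0).symm
      _ = (‖ζ p₀‖ * Complex.exp ((ζ p₀).arg * Complex.I)) *
          (‖ζ p / ζ p₀‖ * Complex.exp ((ζ p / ζ p₀).arg * Complex.I)) := by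
        rw [Complex.norm_mul_exp_arg_mul_I, Complex.norm_mul_exp_arg_mul_I]
      _ = (‖ζ p₀‖ * ‖ζ p / ζ p₀‖ : ℝ) *
          Complex.exp (((ζ p₀).arg + (Complex.log (ζ p / ζ p₀)).im : ℝ) * Complex.I) := by
        rw [Complex.log_im]
        push_cast
        rw [add_mul, Complex.exp_add]
        ring
      _ = _ := by rw [← norm_mul, mul_div_cancel₀ _ h0]

theorem exists_contMDiffOn_eq_ofReal_mul (hζ : ContMDiffOn I 𝓘(ℝ, ℂ) ∞ ζ O)
    (hη : ContMDiffOn I 𝓘(ℝ, ℂ) ∞ η O) (h0 : ∀ p ∈ O, η p ≠ 0)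
    (him : ∀ p ∈ O, (ζ p * conj (η p)).im = 0) :
    ∃ r : M → ℝ, ContMDiffOn I 𝓘(ℝ, ℝ) ∞ r O ∧ ∀ p ∈ O, ζ p = r p * η p := by
  refine ⟨fun p => (ζ p / η p).re, contMDiffOn_comp_of_contDiffAt
    (g := fun z : ℂ × ℂ => (z.1 * z.2⁻¹).re) (fun p hp => Complex.reCLM.contDiff.contDiffAt.comp
      (ζ p, η p) (contDiffAt_fst.mul (contDiffAt_snd.inv (h0 p hp)))) (hζ.prodMk_space hη),
    fun p hp => ?_⟩
  have hquot : (ζ p / η p).im = 0 := by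
    rw [← mul_div_mul_right _ _ ((map_ne_zero (starRingEnd ℂ)).2 (h0 p hp)), Complex.mul_conj,
      Complex.div_ofReal_im, him p hp, zero_div]
  rw [show (((ζ p / η p).re : ℝ) : ℂ) = ζ p / η p from Complex.ext rfl hquot.symm,
    div_mul_cancel₀ _ (h0 p hp)]

end Argument

theorem locallyOnOpenDense_of_forall_open {M : Type*} [TopologicalSpace M]
    {Q : Set M → Prop}
    (h : ∀ W, IsOpen W → W.Nonempty → ∃ O ⊆ W, IsOpen O ∧ O.Nonempty ∧ Q O) :
    LocallyOnOpenDense Q := by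
  refine ⟨{p | ∃ O, IsOpen O ∧ p ∈ O ∧ Q O}, isOpen_iff_forall_mem_open.2 ?_,
    dense_iff_inter_open.2 fun W hW hne => ?_, fun _ hp => hp⟩
  · rintro p ⟨O, hO, hp, hQ⟩
    exact ⟨O, fun q hq => ⟨O, hO, hq, hQ⟩, hO, hp⟩
  · obtain ⟨O, hOW, hO, ⟨p, hp⟩, hQ⟩ := h W hW hne
    exact ⟨p, hOW hp, O, hO, hp, hQ⟩

section Types

variable {M : Type*} [TopologicalSpace M] [ChartedSpace (EuclideanSpace ℝ (Fin 2)) M]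
  {f : M → CP3} {O : Set M} {v : M → C4} {p : M}

theorem IsLiftOn.nkMetric_kahlerJ_eq (hv : IsLiftOn f O v) (hO : IsOpen O)
    (hTR : IsNKTotallyReal f) (hp : p ∈ O) (X Y : TangentSpace (𝓡 2) p) :
    nkMetric (f p) (surfD f p X) (kahlerJ (f p) (surfD f p Y)) =
      2 * (contactForm v p X * conj (contactForm v p Y)).im := by
  have h := hTR p X Y
  rw [hv.surfD_eq hO hp, hv.surfD_eq hO hp] at h ⊢
  rw [nkMetric_hopfPushAt_kahlerJ (hv.norm_eq p hp) (hv.hopf_eq p hp), h, zero_add,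
    contactForm_apply, contactForm_apply]

variable [IsManifold (𝓡 2) ∞ M] {U V : ∀ p : M, TangentSpace (𝓡 2) p}

theorem IsOrthonormalFrameOn.fubiniStudy_kahlerJ_eq_zero_iff (h : IsOrthonormalFrameOn f O U V)
    (hTR : IsNKTotallyReal f) (hp : p ∈ O) :
    (∀ X Y : TangentSpace (𝓡 2) p,
      fubiniStudy (f p) (surfD f p X) (kahlerJ (f p) (surfD f p Y)) = 0) ↔
    nkMetric (f p) (surfD f p (V p)) (kahlerJ (f p) (surfD f p (U p))) = 0 := by
  have hmetric : ∀ X Y : TangentSpace (𝓡 2) p,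
      4 * fubiniStudy (f p) (surfD f p X) (kahlerJ (f p) (surfD f p Y)) =
        3 * nkMetric (f p) (surfD f p X) (kahlerJ (f p) (surfD f p Y)) := fun X Y => by
    rw [four_mul_fubiniStudy_kahlerJ, hTR, sub_zero]
  refine ⟨fun h0 => ?_, fun h0 X Y => ?_⟩
  · linarith [hmetric (V p) (U p), h0 (V p) (U p)]
  · obtain ⟨a, b, rfl⟩ := h.exists_eq_combination hp X
    obtain ⟨c, d, rfl⟩ := h.exists_eq_combination hp Y
    have hXY := hmetric (a • U p + b • V p) (c • U p + d • V p)
    simp only [map_add, map_smul] at hXY ⊢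
    rw [nkMetric_combination_kahlerJ, h0] at hXY
    linarith

theorem IsOrthonormalFrameOn.exists_kahlerJ_eq_iff (h : IsOrthonormalFrameOn f O U V)
    (hp : p ∈ O) :
    (∀ X : TangentSpace (𝓡 2) p, ∃ Y : TangentSpace (𝓡 2) p,
      kahlerJ (f p) (surfD f p X) = surfD f p Y) ↔
    nkMetric (f p) (surfD f p (V p)) (kahlerJ (f p) (surfD f p (U p))) ^ 2 = 1 := by
  refine ⟨fun h0 => ?_, fun h0 X => ?_⟩
  · obtain ⟨Y, hY⟩ := h0 (U p)
    obtain ⟨a, b, rfl⟩ := h.exists_eq_combination hp Y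
    exact sq_nkMetric_kahlerJ_eq_one (h.fst_fst p hp) (h.snd_snd p hp) (h.fst_snd p hp)
      (hY.trans (by rw [map_add, map_smul, map_smul]))
  · obtain ⟨a, b, rfl⟩ := h.exists_eq_combination hp X
    have hU := kahlerJ_eq_smul (h.fst_fst p hp) (h.snd_snd p hp) h0
    have hV := kahlerJ_eq_smul (h.snd_snd p hp) (h.fst_fst p hp)
      (by rwa [nkMetric_kahlerJ_antisymm, neg_sq])
    refine ⟨a • nkMetric (f p) (surfD f p (V p)) (kahlerJ (f p) (surfD f p (U p))) • V p +
      b • nkMetric (f p) (surfD f p (U p)) (kahlerJ (f p) (surfD f p (V p))) • U p, ?_⟩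
    rw [map_add, map_smul, map_smul, kahlerJ_add, kahlerJ_smul, kahlerJ_smul]
    nth_rewrite 1 [hU, hV]
    rw [map_add, map_smul, map_smul, map_smul, map_smul]

theorem IsOrthonormalFrameOn.continuousOn_nkMetric_kahlerJ (h : IsOrthonormalFrameOn f O U V)
    (hTR : IsNKTotallyReal f) (hv : IsLiftOn f O v) (hO : IsOpen O) :
    ContinuousOn (fun p => nkMetric (f p) (surfD f p (V p))
      (kahlerJ (f p) (surfD f p (U p)))) O := by
  refine ContinuousOn.congr ?_ fun p hp => hv.nkMetric_kahlerJ_eq hO hTR hp (V p) (U p)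
  exact continuousOn_const.mul (Complex.continuous_im.comp_continuousOn
    ((hv.contMDiffOn_contactForm hO h.smooth_snd).continuousOn.mul
      (Complex.continuous_conj.comp_continuousOn
        (hv.contMDiffOn_contactForm hO h.smooth_fst).continuousOn)))

theorem forall_of_dense (hf : IsImmersedSurface f) (hTR : IsNKTotallyReal f) {D : Set M}
    (hD : Dense D) {P : M → Prop} {S : Set ℝ} (hS : IsClosed S)
    (hP : ∀ {O U V}, IsOrthonormalFrameOn f O U V → ∀ {p}, p ∈ O →
      (P p ↔ nkMetric (f p) (surfD f p (V p)) (kahlerJ (f p) (surfD f p (U p))) ∈ S))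
    (h : ∀ p ∈ D, P p) (p : M) : P p := by
  obtain ⟨O, hO, hp, v, U, V, hv, hUV⟩ := exists_isLiftOn_isOrthonormalFrameOn hf p
  by_contra hne
  obtain ⟨q, ⟨hqO, hqS⟩, hqD⟩ := hD.inter_open_nonempty _
    ((hUV.continuousOn_nkMetric_kahlerJ hTR hv hO).isOpen_inter_preimage hO hS.isOpen_compl)
    ⟨p, hp, fun hpS => hne ((hP hUV hp).2 hpS)⟩
  exact hqS ((hP hUV hqO).1 (h q hqD))

/-- On `O` the surface is of Type 0 with `λ = 0` or of Type 2 with `cos α = 0`: the local forms of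
the surfaces which are totally real for `J∘`. -/
def IsTotallyRealTypeOn (f : M → CP3) (O : Set M) : Prop :=
  (∃ lam : M → ℝ, IsType0On f O lam ∧ ∀ p ∈ O, lam p = 0) ∨
    ∃ α : M → ℝ, IsType2On f O α ∧ ∀ p ∈ O, Real.cos (α p) = 0

/-- On `O` the surface is of Type 2 with `sin α = 0`: the local form of the surfaces which are
almost complex for `J∘`. -/
def IsAlmostComplexTypeOn (f : M → CP3) (O : Set M) : Prop :=
  ∃ α : M → ℝ, IsType2On f O α ∧ ∀ p ∈ O, Real.sin (α p) = 0

theorem IsTotallyRealTypeOn.fubiniStudy_kahlerJ (h : IsTotallyRealTypeOn f O)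
    (hTR : IsNKTotallyReal f) (hp : p ∈ O) :
    ∀ X Y : TangentSpace (𝓡 2) p,
      fubiniStudy (f p) (surfD f p X) (kahlerJ (f p) (surfD f p Y)) = 0 := by
  obtain ⟨lam, ⟨U, V, α, θ, hUV, -, -, -, hJ⟩, hlam⟩ | ⟨α, ⟨U, V, hUV, -, hJ⟩, hcos⟩ := h <;>
    refine (hUV.fubiniStudy_kahlerJ_eq_zero_iff hTR hp).2 ?_
  · have hJV := (hJ p hp).2.2
    rw [hlam p hp] at hJV
    simp only [zero_div, zero_mul, neg_zero, zero_smul, ne_eq, OfNat.ofNat_ne_zero,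
      not_false_eq_true, zero_pow, add_zero, zero_add, div_one, one_smul] at hJV
    rw [nkMetric_kahlerJ_antisymm, hJV, hTR, neg_zero]
  · have hJU := (hJ p hp).1
    simp only [hcos p hp, zero_smul, add_zero, zero_add] at hJU
    rw [hJU, nkMetric_smul_right, hTR, mul_zero]

theorem IsAlmostComplexTypeOn.exists_kahlerJ_eq (h : IsAlmostComplexTypeOn f O) (hp : p ∈ O) :
    ∀ X : TangentSpace (𝓡 2) p, ∃ Y : TangentSpace (𝓡 2) p,
      kahlerJ (f p) (surfD f p X) = surfD f p Y := by
  obtain ⟨α, ⟨U, V, hUV, -, hJ⟩, hsin⟩ := h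
  refine (hUV.exists_kahlerJ_eq_iff hp).2 ?_
  have hJU := (hJ p hp).1
  simp only [hsin p hp, zero_smul, add_zero] at hJU
  exact sq_nkMetric_kahlerJ_eq_one (a := 0) (hUV.fst_fst p hp) (hUV.snd_snd p hp)
    (hUV.fst_snd p hp) (by rw [hJU, zero_smul, zero_add])

theorem IsOrthonormalFrameOn.isAlmostComplexTypeOn (h : IsOrthonormalFrameOn f O U V) {t : ℝ}
    (ht : Real.sin t = 0)
    (hβ : ∀ p ∈ O, nkMetric (f p) (surfD f p (V p)) (kahlerJ (f p) (surfD f p (U p))) =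
      Real.cos t) : IsAlmostComplexTypeOn f O := by
  have hsq : Real.cos t ^ 2 = 1 := by rw [Real.cos_sq', ht, zero_pow two_ne_zero, sub_zero]
  refine ⟨fun _ => t, ⟨U, V, h, contMDiffOn_const, fun p hp => ?_⟩, fun _ _ => ht⟩
  have hU := kahlerJ_eq_smul (h.fst_fst p hp) (h.snd_snd p hp) (by rw [hβ p hp, hsq])
  have hV := kahlerJ_eq_smul (h.snd_snd p hp) (h.fst_fst p hp)
    (by rw [nkMetric_kahlerJ_antisymm, neg_sq, hβ p hp, hsq])
  rw [hβ p hp] at hU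
  rw [nkMetric_kahlerJ_antisymm, hβ p hp] at hV
  simp only [KahlerJInFrame, ht, neg_zero, zero_smul, add_zero]
  exact ⟨hU, hV⟩

theorem exists_isAlmostComplexTypeOn (hf : IsImmersedSurface f) (hTR : IsNKTotallyReal f)
    (hC : IsKahlerAlmostComplex f) (p₀ : M) :
    ∃ O, IsOpen O ∧ p₀ ∈ O ∧ IsAlmostComplexTypeOn f O := by
  obtain ⟨O, hO, hp₀, v, U, V, hv, hUV⟩ := exists_isLiftOn_isOrthonormalFrameOn hf p₀
  let β := fun p => nkMetric (f p) (surfD f p (V p)) (kahlerJ (f p) (surfD f p (U p)))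
  have hβ : ∀ p ∈ O, β p ^ 2 = 1 := fun p hp => (hUV.exists_kahlerJ_eq_iff hp).1 (hC p)
  have hopen := ((hUV.continuousOn_nkMetric_kahlerJ hTR hv hO).mul
    (continuousOn_const (c := β p₀))).isOpen_inter_preimage hO
      (isOpen_Ioi (a := 0))
  refine ⟨_, hopen, ⟨hp₀, ?_⟩, (hUV.mono Set.inter_subset_left).isAlmostComplexTypeOn
    (t := Real.arccos (β p₀)) ?_ fun p hp => ?_⟩
  · change 0 < β p₀ * β p₀
    rw [← sq, hβ p₀ hp₀]
    exact one_pos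
  · rw [Real.sin_arccos, hβ p₀ hp₀, sub_self, Real.sqrt_zero]
  · have habs := abs_le.1 ((sq_le_one_iff_abs_le_one (β p₀)).1 (hβ p₀ hp₀).le)
    rw [Real.cos_arccos habs.1 habs.2]
    refine (sq_eq_sq_iff_eq_or_eq_neg.1 ((hβ p hp.1).trans (hβ p₀ hp₀).symm)).resolve_right
      fun hneg => ?_
    have hpos : 0 < β p * β p₀ := hp.2
    rw [hneg, neg_mul, ← sq, hβ p₀ hp₀] at hpos
    linarith

end Types

/-! ### Surfaces totally real for `J∘` -/

theorem one_sub_two_mul_sq_mem_Ioo {x : ℝ} (h0 : 0 < x) (h1 : x < 1) :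
    1 - 2 * x ^ 2 ∈ Set.Ioo (-1 : ℝ) 1 :=
  ⟨by linarith [(sq_lt_one_iff₀ h0.le).2 h1], by linarith [sq_pos_of_pos h0]⟩

section AdaptedFrames

variable {M : Type*} [TopologicalSpace M] [ChartedSpace (EuclideanSpace ℝ (Fin 2)) M]
  {f : M → CP3} {O W : Set M} {v : M → C4} {p : M}

/-- For a totally real frame `U = X`, `V = Y` on which the contact form of the lift `v` satisfies
`contactForm v p Y = 0`, this is the complex number `b₄ + i b₅` formed by the coefficients of
`G(U, V)` and `J G(U, V)` in `J∘ U`. -/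
noncomputable def crossCoeff (v : M → C4) (p : M) (X Y : TangentSpace (𝓡 2) p) : ℂ :=
  -4 * (conj (contactForm v p X) * inner ℂ (quatJ (horizontalLift v p X)) (horizontalLift v p Y))

theorem IsLiftOn.kahlerJ_surfD_eq_nkJ (hv : IsLiftOn f O v) (hO : IsOpen O) (hp : p ∈ O)
    {X : TangentSpace (𝓡 2) p} (hX : contactForm v p X = 0) :
    kahlerJ (f p) (surfD f p X) = nkJ (f p) (surfD f p X) := by
  rw [hv.surfD_eq hO hp]
  exact kahlerJ_hopfPushAt_eq_nkJ (hv.norm_eq p hp) (hv.hopf_eq p hp) hX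

variable [IsManifold (𝓡 2) ∞ M] {U V : ∀ p : M, TangentSpace (𝓡 2) p}

theorem IsLiftOn.contMDiffOn_crossCoeff (hv : IsLiftOn f O v) (hO : IsOpen O)
    (hU : ContMDiffOn (𝓡 2) (𝓡 2).tangent ∞ (fun p => (⟨p, U p⟩ : TangentBundle (𝓡 2) M)) O)
    (hV : ContMDiffOn (𝓡 2) (𝓡 2).tangent ∞ (fun p => (⟨p, V p⟩ : TangentBundle (𝓡 2) M)) O) :
    ContMDiffOn (𝓡 2) 𝓘(ℝ, ℂ) ∞ (fun p => crossCoeff v p (U p) (V p)) O := by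
  have hinner := contMDiffOn_inner (contMDiffOn_quatJ (hv.contMDiffOn_horizontalLift hO hU))
    (hv.contMDiffOn_horizontalLift hO hV)
  have hsmooth : ContDiff ℝ ∞ fun z : ℂ × ℂ => -4 * (conj z.1 * z.2) := by
    simp only [← Complex.conjCLE_apply]
    fun_prop
  exact (contMDiffOn_comp_of_contDiff hsmooth
    ((hv.contMDiffOn_contactForm hO hU).prodMk_space hinner)).congr fun _ _ => rfl

namespace IsOrthonormalFrameOn

theorem norm_sq_contactForm_add (h : IsOrthonormalFrameOn f O U V) (hTR : IsNKTotallyReal f)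
    (hv : IsLiftOn f O v) (hO : IsOpen O) (hp : p ∈ O) :
    ‖contactForm v p (U p)‖ ^ 2 + ‖contactForm v p (V p)‖ ^ 2 +
      4 * ‖inner ℂ (quatJ (horizontalLift v p (U p))) (horizontalLift v p (V p))‖ ^ 2 = 1 := by
  have hpair := h.isTotallyRealPair hTR hp
  rw [hv.surfD_eq hO hp, hv.surfD_eq hO hp] at hpair
  exact hpair.norm_sq_inner_quatJ_add (hv.norm_eq p hp) (hv.hopf_eq p hp)
    (hv.inner_horizontalLift hp _) (hv.inner_horizontalLift hp _)

theorem norm_contactForm_fst_le_one (h : IsOrthonormalFrameOn f O U V) (hTR : IsNKTotallyReal f)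
    (hv : IsLiftOn f O v) (hO : IsOpen O) (hp : p ∈ O) : ‖contactForm v p (U p)‖ ≤ 1 := by
  rw [← sq_le_one_iff₀ (norm_nonneg _), ← h.norm_sq_contactForm_add hTR hv hO hp, add_assoc]
  exact le_add_of_nonneg_right (by positivity)

theorem norm_sq_crossCoeff (h : IsOrthonormalFrameOn f O U V) (hTR : IsNKTotallyReal f)
    (hv : IsLiftOn f O v) (hO : IsOpen O) (hp : p ∈ O) (hV : contactForm v p (V p) = 0) :
    ‖crossCoeff v p (U p) (V p)‖ ^ 2 = 1 - (1 - 2 * ‖contactForm v p (U p)‖ ^ 2) ^ 2 := by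
  have hsum := h.norm_sq_contactForm_add hTR hv hO hp
  rw [hV, norm_zero] at hsum
  rw [crossCoeff, norm_mul, norm_mul, norm_neg, Complex.norm_ofNat, RCLike.norm_conj]
  linear_combination 4 * ‖contactForm v p (U p)‖ ^ 2 * hsum

theorem kahlerJ_surfD_fst (h : IsOrthonormalFrameOn f O U V) (hTR : IsNKTotallyReal f)
    (hv : IsLiftOn f O v) (hO : IsOpen O) (hp : p ∈ O) (hV : contactForm v p (V p) = 0) :
    kahlerJ (f p) (surfD f p (U p)) =
      (1 - 2 * ‖contactForm v p (U p)‖ ^ 2) • nkJ (f p) (surfD f p (U p))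
        + (crossCoeff v p (U p) (V p)).re • nablaJ (f p) (surfD f p (U p)) (surfD f p (V p))
        + (crossCoeff v p (U p) (V p)).im •
          nkJ (f p) (nablaJ (f p) (surfD f p (U p)) (surfD f p (V p))) := by
  have hpair := h.isTotallyRealPair hTR hp
  rw [hv.surfD_eq hO hp, hv.surfD_eq hO hp] at hpair ⊢
  exact hpair.kahlerJ_hopfPushAt_eq (hv.norm_eq p hp) (hv.hopf_eq p hp)
    (hv.inner_horizontalLift hp _) (hv.inner_horizontalLift hp _) hV rfl

theorem isType2On_neg_pi_div_two (h : IsOrthonormalFrameOn f O U V) (hTR : IsNKTotallyReal f)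
    (hv : IsLiftOn f O v) (hO : IsOpen O) (hV : ∀ p ∈ O, contactForm v p (V p) = 0)
    (hU : ∀ p ∈ O, ‖contactForm v p (U p)‖ = 1) : IsType2On f O fun _ => -(Real.pi / 2) := by
  refine ⟨U, V, h, contMDiffOn_const, fun p hp => ?_⟩
  have hz : crossCoeff v p (U p) (V p) = 0 := norm_eq_zero.1 <| sq_eq_zero_iff.1 <| by
    rw [h.norm_sq_crossCoeff hTR hv hO hp (hV p hp), hU p hp]
    norm_num
  have hJU := h.kahlerJ_surfD_fst hTR hv hO hp (hV p hp)
  have hJV := hv.kahlerJ_surfD_eq_nkJ hO hp (hV p hp)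
  rw [hz, hU p hp] at hJU
  simp only [KahlerJInFrame, Real.cos_neg, Real.sin_neg, Real.cos_pi_div_two,
    Real.sin_pi_div_two, neg_neg, neg_zero, zero_smul, add_zero, zero_add, one_smul]
  exact ⟨hJU.trans (by norm_num), hJV⟩

theorem isType0On_zero (h : IsOrthonormalFrameOn f O U V) (hTR : IsNKTotallyReal f)
    (hv : IsLiftOn f O v) (hO : IsOpen O) (hV : ∀ p ∈ O, contactForm v p (V p) = 0)
    (hU0 : ∀ p ∈ O, contactForm v p (U p) ≠ 0) (hU1 : ∀ p ∈ O, ‖contactForm v p (U p)‖ < 1)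
    {ψ : M → ℝ} (hψ : ContMDiffOn (𝓡 2) 𝓘(ℝ, ℝ) ∞ ψ O)
    (hz : ∀ p ∈ O, crossCoeff v p (U p) (V p) =
      ‖crossCoeff v p (U p) (V p)‖ * Complex.exp (ψ p * Complex.I)) :
    IsType0On f O fun _ => 0 := by
  have hsin : ∀ p ∈ O, 1 - 2 * ‖contactForm v p (U p)‖ ^ 2 ∈ Set.Ioo (-1 : ℝ) 1 := fun p hp =>
    one_sub_two_mul_sq_mem_Ioo (norm_pos_iff.2 (hU0 p hp)) (hU1 p hp)
  have hcos : ∀ p ∈ O, Real.cos (Real.arcsin (1 - 2 * ‖contactForm v p (U p)‖ ^ 2)) =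
      ‖crossCoeff v p (U p) (V p)‖ := fun p hp => by
    rw [Real.cos_arcsin, ← h.norm_sq_crossCoeff hTR hv hO hp (hV p hp),
      Real.sqrt_sq (norm_nonneg _)]
  have hα : ContMDiffOn (𝓡 2) 𝓘(ℝ, ℝ) ∞
      (fun p => Real.arcsin (1 - 2 * ‖contactForm v p (U p)‖ ^ 2)) O :=
    contMDiffOn_comp_of_contDiffAt (fun p hp =>
      Real.contDiffAt_arcsin (hsin p hp).1.ne' (hsin p hp).2.ne)
      (contMDiffOn_comp_of_contDiff (g := fun c : ℂ => 1 - 2 * ‖c‖ ^ 2)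
        (contDiff_const.sub (contDiff_const.mul (contDiff_norm_sq ℝ)))
        (hv.contMDiffOn_contactForm hO h.smooth_fst))
  refine ⟨U, V, _, fun p => Real.pi / 2 - ψ p, h, contMDiffOn_const, hα,
    contMDiffOn_const.sub hψ, fun p hp => ⟨⟨Real.neg_pi_div_two_lt_arcsin.2 (hsin p hp).1,
      Real.arcsin_lt_pi_div_two.2 (hsin p hp).2⟩, ?_⟩⟩
  have hJU := h.kahlerJ_surfD_fst hTR hv hO hp (hV p hp)
  rw [hz p hp, Complex.re_ofReal_mul, Complex.im_ofReal_mul, Complex.exp_ofReal_mul_I_re,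
    Complex.exp_ofReal_mul_I_im] at hJU
  simp only [KahlerJInFrame, Real.sin_arcsin (hsin p hp).1.le (hsin p hp).2.le, hcos p hp,
    Real.sin_pi_div_two_sub, Real.cos_pi_div_two_sub, zero_mul, neg_zero, zero_smul, ne_eq,
    OfNat.ofNat_ne_zero, not_false_eq_true, zero_pow, add_zero, zero_add, div_one, one_smul,
    Real.sqrt_one]
  exact ⟨hJU, hv.kahlerJ_surfD_eq_nkJ hO hp (hV p hp)⟩

theorem exists_isType0On_zero (h : IsOrthonormalFrameOn f O U V) (hTR : IsNKTotallyReal f)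
    (hv : IsLiftOn f O v) (hO : IsOpen O) (hV : ∀ p ∈ O, contactForm v p (V p) = 0)
    (hU0 : ∀ p ∈ O, contactForm v p (U p) ≠ 0) (hU1 : ∀ p ∈ O, ‖contactForm v p (U p)‖ < 1)
    {p₀ : M} (hp₀ : p₀ ∈ O) :
    ∃ O' ⊆ O, IsOpen O' ∧ p₀ ∈ O' ∧ IsType0On f O' fun _ => 0 := by
  have hz₀ : crossCoeff v p₀ (U p₀) (V p₀) ≠ 0 := fun hz => by
    obtain ⟨hlt, hgt⟩ := one_sub_two_mul_sq_mem_Ioo (norm_pos_iff.2 (hU0 p₀ hp₀)) (hU1 p₀ hp₀)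
    have hsq := h.norm_sq_crossCoeff hTR hv hO hp₀ (hV p₀ hp₀)
    rw [hz, norm_zero] at hsq
    nlinarith
  obtain ⟨O', hO', hO'o, hp₀', ψ, hψ, hz⟩ := exists_contMDiffOn_eq_norm_mul_exp hO
    (hv.contMDiffOn_crossCoeff hO h.smooth_fst h.smooth_snd) hp₀ hz₀
  exact ⟨O', hO', hO'o, hp₀', (h.mono hO').isType0On_zero hTR (hv.mono hO') hO'o
    (fun p hp => hV p (hO' hp)) (fun p hp => hU0 p (hO' hp)) (fun p hp => hU1 p (hO' hp)) hψ hz⟩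

theorem exists_isTotallyRealTypeOn_of_snd_eq_zero (h : IsOrthonormalFrameOn f O U V)
    (hTR : IsNKTotallyReal f) (hv : IsLiftOn f O v) (hO : IsOpen O) (hne : O.Nonempty)
    (hV : ∀ p ∈ O, contactForm v p (V p) = 0) (hU : ∀ p ∈ O, contactForm v p (U p) ≠ 0) :
    ∃ O' ⊆ O, IsOpen O' ∧ O'.Nonempty ∧ IsTotallyRealTypeOn f O' := by
  by_cases hlt : ∃ p ∈ O, ‖contactForm v p (U p)‖ < 1
  · obtain ⟨p, hp, hlt⟩ := hlt
    have hO₁ := (hv.contMDiffOn_contactForm hO h.smooth_fst).continuousOn.norm.isOpen_inter_preimage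
      hO (isOpen_Iio (a := (1 : ℝ)))
    have hsub := Set.inter_subset_left (s := O)
      (t := (fun p => ‖contactForm v p (U p)‖) ⁻¹' Set.Iio 1)
    obtain ⟨O', hO', hO'o, hp', htype⟩ := (h.mono hsub).exists_isType0On_zero hTR (hv.mono hsub)
      hO₁ (fun p hp => hV p hp.1) (fun p hp => hU p hp.1) (fun p hp => hp.2) ⟨hp, hlt⟩
    exact ⟨O', hO'.trans hsub, hO'o, ⟨p, hp'⟩, Or.inl ⟨_, htype, fun _ _ => rfl⟩⟩
  · push Not at hlt
    refine ⟨O, subset_rfl, hO, hne, Or.inr ⟨_, h.isType2On_neg_pi_div_two hTR hv hO hV fun p hp =>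
      (h.norm_contactForm_fst_le_one hTR hv hO hp).antisymm (hlt p hp), fun _ _ => ?_⟩⟩
    rw [Real.cos_neg, Real.cos_pi_div_two]

theorem exists_contactForm_snd_eq_zero (h : IsOrthonormalFrameOn f O U V) (hv : IsLiftOn f O v)
    (hO : IsOpen O) (hU : ∀ p ∈ O, contactForm v p (U p) ≠ 0)
    (him : ∀ p ∈ O, (contactForm v p (V p) * conj (contactForm v p (U p))).im = 0) :
    ∃ U' V', IsOrthonormalFrameOn f O U' V' ∧
      ∀ p ∈ O, contactForm v p (V' p) = 0 ∧ contactForm v p (U' p) ≠ 0 := by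
  obtain ⟨r, hr, hVU⟩ := exists_contMDiffOn_eq_ofReal_mul
    (hv.contMDiffOn_contactForm hO h.smooth_snd) (hv.contMDiffOn_contactForm hO h.smooth_fst)
    hU him
  have hpos : ∀ p, 0 < 1 + r p ^ 2 := fun p => by positivity
  let c := fun p => (√(1 + r p ^ 2))⁻¹
  have hc : ContMDiffOn (𝓡 2) 𝓘(ℝ, ℝ) ∞ c O := contMDiffOn_inv_sqrt
    (contMDiffOn_comp_of_contDiff (g := fun t : ℝ => 1 + t ^ 2) (by fun_prop) hr) fun p _ => hpos p
  have hc0 : ∀ p, c p ≠ 0 := fun p => inv_ne_zero (Real.sqrt_ne_zero'.2 (hpos p))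
  have hcsq : ∀ p, c p ^ 2 * (1 + r p ^ 2) = 1 := fun p => by
    rw [inv_pow, Real.sq_sqrt (hpos p).le, inv_mul_cancel₀ (hpos p).ne']
  refine ⟨_, _, h.rotate hc (hr.mul hc) fun p _ => by
    simp only [Pi.mul_apply]
    linear_combination hcsq p, fun p hp => ⟨?_, ?_⟩⟩
  · rw [map_add, map_smul, map_smul, hVU p hp, Complex.real_smul, Complex.real_smul]
    simp only [Pi.mul_apply]
    push_cast
    ring
  · have hU' : contactForm v p (c p • U p + (r p * c p) • V p) =
        ((c p * (1 + r p ^ 2) : ℝ) : ℂ) * contactForm v p (U p) := by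
      rw [map_add, map_smul, map_smul, hVU p hp, Complex.real_smul, Complex.real_smul]
      push_cast
      ring
    exact hU' ▸ mul_ne_zero (Complex.ofReal_ne_zero.2 (mul_ne_zero (hc0 p) (hpos p).ne')) (hU p hp)

theorem exists_isTotallyRealTypeOn (h : IsOrthonormalFrameOn f O U V) (hTR : IsNKTotallyReal f)
    (hv : IsLiftOn f O v) (hO : IsOpen O) (hp : p ∈ O) (hU : contactForm v p (U p) ≠ 0)
    (him : ∀ p ∈ O, (contactForm v p (V p) * conj (contactForm v p (U p))).im = 0) :
    ∃ O' ⊆ O, IsOpen O' ∧ O'.Nonempty ∧ IsTotallyRealTypeOn f O' := by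
  have hO₁ := (hv.contMDiffOn_contactForm hO h.smooth_fst).continuousOn.isOpen_inter_preimage hO
    (isOpen_ne (x := 0))
  have hsub := Set.inter_subset_left (s := O)
    (t := (fun p => contactForm v p (U p)) ⁻¹' {z | z ≠ 0})
  obtain ⟨U', V', h', hUV'⟩ := (h.mono hsub).exists_contactForm_snd_eq_zero (hv.mono hsub) hO₁
    (fun p hp => hp.2) fun p hp => him p hp.1
  obtain ⟨O', hO', htype⟩ := h'.exists_isTotallyRealTypeOn_of_snd_eq_zero hTR (hv.mono hsub) hO₁
    ⟨p, hp, hU⟩ (fun p hp => (hUV' p hp).1) fun p hp => (hUV' p hp).2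
  exact ⟨O', hO'.trans hsub, htype⟩

theorem exists_contactForm_ne_zero (h : IsOrthonormalFrameOn f O U V) (hTR : IsNKTotallyReal f)
    (hv : IsLiftOn f O v) (hO : IsOpen O) (hne : O.Nonempty) :
    ∃ p ∈ O, contactForm v p (U p) ≠ 0 ∨ contactForm v p (V p) ≠ 0 := by
  by_contra! hzero
  have hcontact : ∀ p ∈ O, contactForm v p = 0 := fun p hp => LinearMap.ext fun X => by
    obtain ⟨a, b, rfl⟩ := h.exists_eq_combination hp X
    rw [map_add, map_smul, map_smul, (hzero p hp).1, (hzero p hp).2, smul_zero, smul_zero,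
      add_zero, LinearMap.zero_apply]
  obtain ⟨p, hp⟩ := hne
  have hsum := h.norm_sq_contactForm_add hTR hv hO hp
  rw [hv.inner_quatJ_horizontalLift_eq_zero hO hcontact hp, (hzero p hp).1, (hzero p hp).2] at hsum
  norm_num at hsum

end IsOrthonormalFrameOn

theorem exists_isTotallyRealTypeOn (hf : IsImmersedSurface f) (hTR : IsNKTotallyReal f)
    (hR : IsKahlerTotallyReal f) (hW : IsOpen W) (hne : W.Nonempty) :
    ∃ O ⊆ W, IsOpen O ∧ O.Nonempty ∧ IsTotallyRealTypeOn f O := by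
  obtain ⟨p₀, hp₀⟩ := hne
  obtain ⟨O₀, hO₀, hpO₀, v, U, V, hv, h⟩ := exists_isLiftOn_isOrthonormalFrameOn hf p₀
  have hO := hO₀.inter hW
  replace hv := hv.mono (Set.inter_subset_left (t := W))
  replace h := h.mono (Set.inter_subset_left (t := W))
  have him : ∀ {U V}, IsOrthonormalFrameOn f (O₀ ∩ W) U V → ∀ p ∈ O₀ ∩ W,
      (contactForm v p (V p) * conj (contactForm v p (U p))).im = 0 := fun h p hp => by
    have hβ := (h.fubiniStudy_kahlerJ_eq_zero_iff hTR hp).1 (hR p)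
    rw [hv.nkMetric_kahlerJ_eq hO hTR hp] at hβ
    exact (mul_eq_zero_iff_left two_ne_zero).1 hβ
  obtain ⟨p, hp, hU | hV⟩ := h.exists_contactForm_ne_zero hTR hv hO ⟨p₀, hpO₀, hp₀⟩
  · obtain ⟨O, hOW, htype⟩ := h.exists_isTotallyRealTypeOn hTR hv hO hp hU (him h)
    exact ⟨O, hOW.trans Set.inter_subset_right, htype⟩
  · obtain ⟨O, hOW, htype⟩ := h.swap.exists_isTotallyRealTypeOn hTR hv hO hp hV (him h.swap)
    exact ⟨O, hOW.trans Set.inter_subset_right, htype⟩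

end AdaptedFrames

end NKCP3

open NKCP3 in
theorem mainTheorem9 {M : Type*} [TopologicalSpace M]
    [ChartedSpace (EuclideanSpace ℝ (Fin 2)) M] [IsManifold (𝓡 2) ∞ M]
    (f : M → CP3) (hf : IsImmersedSurface f) (hTR : IsNKTotallyReal f) :
    (IsKahlerTotallyReal f ↔
      LocallyOnOpenDense fun O : Set M =>
        (∃ lam : M → ℝ, IsType0On f O lam ∧ ∀ p ∈ O, lam p = 0) ∨
        (∃ α : M → ℝ, IsType2On f O α ∧ ∀ p ∈ O, Real.cos (α p) = 0)) ∧
    (IsKahlerAlmostComplex f ↔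
      LocallyOnOpenDense fun O : Set M =>
        ∃ α : M → ℝ, IsType2On f O α ∧ ∀ p ∈ O, Real.sin (α p) = 0) := by
  refine ⟨⟨fun hR => ?_, ?_⟩, fun hC => ?_, ?_⟩
  · exact locallyOnOpenDense_of_forall_open fun W hW hne =>
      exists_isTotallyRealTypeOn hf hTR hR hW hne
  · rintro ⟨D, -, hD, htype⟩
    refine forall_of_dense hf hTR hD (isClosed_singleton (x := 0))
      (fun hUV _ hp => hUV.fubiniStudy_kahlerJ_eq_zero_iff hTR hp) fun p hp => ?_
    obtain ⟨O, -, hpO, hO⟩ := htype p hp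
    exact IsTotallyRealTypeOn.fubiniStudy_kahlerJ hO hTR hpO
  · exact ⟨Set.univ, isOpen_univ, dense_univ, fun p _ => exists_isAlmostComplexTypeOn hf hTR hC p⟩
  · rintro ⟨D, -, hD, htype⟩
    refine forall_of_dense hf hTR hD (isClosed_eq (continuous_pow 2) continuous_const)
      (fun hUV _ hp => hUV.exists_kahlerJ_eq_iff hp) fun p hp => ?_
    obtain ⟨O, -, hpO, hO⟩ := htype p hp
    exact IsAlmostComplexTypeOn.exists_kahlerJ_eq hO hpO
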